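/- Let $0<q<1$ and $\lambda=-1/\ln q>0$. Let $\tilde{\mathbb C}^*$ be the Riemann surface of the logarithm, identified with $]0,\infty[\times\mathbb R$ through $x=|x|e^{i\arg x}$, with single-valued logarithm $\log x=\ln|x|+i\arg x$. Let $h$ be the solution at infinity of $y'(x)=y(qx)$ that is defined for $x\in\tilde{\mathbb C}^*$ by $$h(x)=\frac{\sqrt\kappa}{2\pi i}\int_{\mathcal C}\exp\Bigl(t-\frac1{2\ln q}\log^2\frac{\sqrt q\,t}{x}\Bigr)\frac{dt}{t},\qquad \kappa=-\frac{2\pi}{\ln q},$$ where $\mathcal C$ is a Hankel contour: it starts at infinity on the negative real axis (with $\arg t=-\pi$), encircles the origin once in the positive direction, and returns to infinity on the negative real axis (with $\arg t=\pi$). Let $W$ be the Lambert function: the solution of $W(z)e^{W(z)}=z$ that is analytic at $z=0$, continued analytically to the points $z\in\tilde{\mathbb C}^*$ with $|z|>1$ (first along $\arg z=0$ and then by varying $\arg z$). Put $\tilde\omega=\tilde\omega(q,x)=\lambda\,W(q^{-3/2}x/\lambda)$. Let $\ell$ be the germ of analytic function at $0$ with $\ell(0)=0$, $\ell'(0)=1$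 and $(\ell(z)-1)e^{\ell(z)-1}=-e^{-1-z^2/2}$, that is, $\ell(z)=W(-e^{-1-z^2/2})+1$, and let $V_n$ be the Taylor coefficients at $0$ of $$V(\sigma)=e^{\frac\lambda2\left(\ell(\sigma)^2+\sigma^2\ell(\sigma)+\frac{\sigma^4}4\right)}\,\ell'(\sigma)=\sum_{n\ge0}V_n\sigma^n .$$ **Theorem.** For every integer $N\ge1$, as $x\to\infty$ in $\tilde{\mathbb C}^*$ (that is, $|x|\to\infty$, uniformly in $\arg x\in\mathbb R$), $$h(x)=\frac1{\sqrt{q\ln(q^{-1})}}\;e^{-\frac{\ln q}2\tilde\omega^2+(1+\ln q)\tilde\omega}\;\frac1{\sqrt{\tilde\omega}}\,\Bigl(1+\sum_{n=1}^N\frac{(2n)!\,V_{2n}}{2^n\,n!}\Bigl(-\frac1{\tilde\omega}\Bigr)^n+O\bigl(\tilde\omega^{-N-1}\bigr)\Bigr),$$ where $\sqrt{\tilde\omega}$ is the principal square root ($\tilde\omega$ does not lie on $(-\infty,0]$ for $|x|$ large). -/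

import Mathlib

open Complex Filter Topology MeasureTheory
open scoped Real Nat

namespace Pantograph

/-! ### The Riemann surface of the logarithm -/

/-- The Riemann surface of the logarithm, identified with `]0, ∞[ × ℝ` through modulus and
argument: the point with modulus `r` and argument `θ` is thought of as `r e^{iθ}`, and points with
arguments differing by `2π` are different. -/
@[ext]
structure LogSurface where
  /-- the modulus `|x|` -/
  modulus : ℝ
  /-- the argument `arg x`, an arbitrary real number -/
  arg : ℝ
  modulus_pos : 0 < modulus

namespace LogSurface

/-- The projection to the punctured complex plane. -/
noncomputable def toComplex (x : LogSurface) : ℂ := x.modulus * exp (x.arg * I)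

/-- The (single-valued) logarithm on its Riemann surface. -/
noncomputable def log (x : LogSurface) : ℂ := (Real.log x.modulus : ℂ) + x.arg * I

/-- Products on the surface: moduli are multiplied, arguments are added. -/
noncomputable instance : Mul LogSurface :=
  ⟨fun x y => ⟨x.modulus * y.modulus, x.arg + y.arg, mul_pos x.modulus_pos y.modulus_pos⟩⟩

/-- Quotients on the surface: moduli are divided, arguments are subtracted. -/
noncomputable instance : Div LogSurface :=
  ⟨fun x y => ⟨x.modulus / y.modulus, x.arg - y.arg, div_pos x.modulus_pos y.modulus_pos⟩⟩

/-- A positive real number as a point of the surface, with argument `0`. -/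
def ofPos (c : ℝ) (hc : 0 < c) : LogSurface := ⟨c, 0, hc⟩

/-- The point of the surface whose logarithm is `Z`. -/
noncomputable def ofLog (Z : ℂ) : LogSurface := ⟨Real.exp Z.re, Z.im, Real.exp_pos _⟩

/-- The filter "`x → ∞` on the Riemann surface of the logarithm": `|x| → ∞`, and nothing is
asked of `arg x`. Its sets are those that contain `{x | |x| > ρ}` for some `ρ`. -/
def atInfinity : Filter LogSurface := comap modulus atTop

@[simp] theorem log_ofLog (Z : ℂ) : (ofLog Z).log = Z := by
  simp [log, ofLog, Complex.re_add_im]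

@[simp] theorem ofLog_log (x : LogSurface) : ofLog x.log = x := by
  ext <;> simp [log, ofLog, Real.exp_log x.modulus_pos]

theorem exp_log (x : LogSurface) : exp x.log = x.toComplex := by
  rw [log, toComplex, Complex.exp_add, ← Complex.ofReal_exp, Real.exp_log x.modulus_pos]

theorem log_mul (x y : LogSurface) : (x * y).log = x.log + y.log := by
  change ((Real.log (x.modulus * y.modulus) : ℝ) : ℂ) + ((x.arg + y.arg : ℝ) : ℂ) * I = _
  rw [Real.log_mul x.modulus_pos.ne' y.modulus_pos.ne']
  simp only [log]; push_cast; ring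

theorem log_div (x y : LogSurface) : (x / y).log = x.log - y.log := by
  change ((Real.log (x.modulus / y.modulus) : ℝ) : ℂ) + ((x.arg - y.arg : ℝ) : ℂ) * I = _
  rw [Real.log_div x.modulus_pos.ne' y.modulus_pos.ne']
  simp only [log]; push_cast; ring

end LogSurface

/-! ### The Lambert function on the Riemann surface of the logarithm -/

open Classical in
/-- The Lambert function `W` on the Riemann surface of the logarithm. Its values satisfy
`W e^W = z` and, away from the cuts at `|z| ≤ 1/e`, they never lie on `(-∞, 0]`; on the surface
the equation therefore reads `W + Log W = log z`, with `Log` the principal logarithm. This equation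
has exactly one solution `W ∈ ℂ ∖ (-∞, 0]` for all `z` with `|z| > 1/e` or `|arg z| < π`
(`lambertW_existsUnique`). The function obtained is analytic there (`lambertW_analyticOnNhd`)
and it is the analytic continuation of the germ at `z = 0` of the analytic solution of
`y e^y = z` (`lambertW_eq_germ`). -/
noncomputable def lambertW (z : LogSurface) : ℂ :=
  if h : ∃ w : ℂ, w ∈ slitPlane ∧ w + Complex.log w = z.log then h.choose else 0

/-- The set of the logarithms of all `z` with `|z| > 1/e` or `|arg z| < π`. -/
def lambertDomain : Set ℂ := {Z : ℂ | -1 < Z.re ∨ |Z.im| < π}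

theorem isOpen_lambertDomain : IsOpen lambertDomain :=
  (isOpen_lt continuous_const continuous_re).union
    (isOpen_lt (continuous_abs.comp continuous_im) continuous_const)

theorem isPreconnected_lambertDomain : IsPreconnected lambertDomain := by
  have h1 : IsPreconnected {Z : ℂ | -1 < Z.re} := (convex_halfSpace_re_gt (-1)).isPreconnected
  have h2 : IsPreconnected {Z : ℂ | |Z.im| < π} := by
    have : {Z : ℂ | |Z.im| < π} = {Z : ℂ | -π < Z.im} ∩ {Z : ℂ | Z.im < π} := by
      ext Z; simp [abs_lt]
    rw [this]
    exact ((convex_halfSpace_im_gt _).inter (convex_halfSpace_im_lt _)).isPreconnected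
  have m1 : (0 : ℂ) ∈ {Z : ℂ | -1 < Z.re} := by simp
  have m2 : (0 : ℂ) ∈ {Z : ℂ | |Z.im| < π} := by simp [Real.pi_pos]
  exact IsPreconnected.union (0 : ℂ) m1 m2 h1 h2

theorem strip_injective {u v : ℂ} (hu : |u.im| < π) (hv : |v.im| < π)
    (h : exp u + u = exp v + v) : u = v := by
  by_contra hne
  have him : Real.exp u.re * Real.sin u.im + u.im = Real.exp v.re * Real.sin v.im + v.im := by
    have := congrArg Complex.im h
    simpa [Complex.exp_im] using this
  have sgn : ∀ w : ℂ, |w.im| < π →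
      (0 < w.im → 0 < Real.exp w.re * Real.sin w.im + w.im) ∧
      (w.im < 0 → Real.exp w.re * Real.sin w.im + w.im < 0) := by
    intro w hw
    rw [abs_lt] at hw
    refine ⟨fun h0 => ?_, fun h0 => ?_⟩
    · have := Real.sin_pos_of_pos_of_lt_pi h0 hw.2
      positivity
    · have := Real.sin_neg_of_neg_of_neg_pi_lt h0 hw.1
      nlinarith [Real.exp_pos w.re]
  -- along the segment from `v` to `u`
  set d := u - v with hd
  have hd0 : d ≠ 0 := sub_ne_zero.2 hne
  let γ : ℝ → ℂ := fun t => v + t * d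
  have hγ : ∀ t : ℝ, HasDerivAt γ d t := by
    intro t
    have : HasDerivAt (fun t : ℝ => (t : ℂ) * d) (1 * d) t :=
      (Complex.ofRealCLM.hasDerivAt (x := t)).mul_const d
    simpa [γ] using this.const_add v
  have hG : ∀ t : ℝ, HasDerivAt (fun t => (exp (γ t) + γ t) / d) (exp (γ t) + 1) t := by
    intro t
    have := (((hγ t).cexp).add (hγ t)).div_const d
    refine HasDerivAt.congr_deriv (f := fun t => (exp (γ t) + γ t) / d) this ?_
    rw [div_eq_iff hd0]
    ring
  have him_γ : ∀ t : ℝ, (γ t).im = (1 - t) * v.im + t * u.im := by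
    intro t; simp [γ, hd]; ring
  rcases lt_trichotomy u.im 0 with hu0 | hu0 | hu0
  · have hv0 : v.im < 0 := by
      by_contra hc
      rcases (not_lt.1 hc).eq_or_lt with h0 | h0
      · have := (sgn u hu).2 hu0
        rw [him, ← h0] at this; simp at this
      · linarith [(sgn u hu).2 hu0, (sgn v hv).1 h0]
    have hIm : ∀ t : ℝ, HasDerivAt (fun t => ((exp (γ t) + γ t) / d).im)
        (exp (γ t) + 1).im t := fun t =>
      (Complex.imCLM.hasFDerivAt.comp_hasDerivAt t (hG t))
    obtain ⟨c, hc, hc'⟩ := exists_hasDerivAt_eq_slope _ _ (zero_lt_one (α := ℝ))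
      (fun t _ => (hIm t).continuousAt.continuousWithinAt) (fun t _ => hIm t)
    have e0 : γ 0 = v := by simp [γ]
    have e1 : γ 1 = u := by simp [γ, hd]
    rw [e0, e1, h, sub_self, zero_div] at hc'
    have h1 : (γ c).im < 0 := by rw [him_γ]; nlinarith [hc.1, hc.2]
    have h2 : -π < (γ c).im := by
      rw [him_γ]; rw [abs_lt] at hu hv; nlinarith [hc.1, hc.2, hu.1, hv.1]
    have h3 := Real.sin_neg_of_neg_of_neg_pi_lt h1 h2
    simp only [Complex.add_im, Complex.exp_im, Complex.one_im, add_zero] at hc'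
    nlinarith [Real.exp_pos (γ c).re]
  · have hv0 : v.im = 0 := by
      rcases lt_trichotomy v.im 0 with h0 | h0 | h0
      · have := (sgn v hv).2 h0
        rw [← him, hu0] at this; simp at this
      · exact h0
      · have := (sgn v hv).1 h0
        rw [← him, hu0] at this; simp at this
    have hre := congrArg Complex.re h
    simp only [Complex.add_re, Complex.exp_re, hu0, hv0, Real.cos_zero, mul_one] at hre
    apply hne
    apply Complex.ext _ (by rw [hu0, hv0])
    rcases lt_trichotomy u.re v.re with h0 | h0 | h0
    · linarith [Real.exp_lt_exp.2 h0]
    · exact h0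
    · linarith [Real.exp_lt_exp.2 h0]
  · have hv0 : 0 < v.im := by
      by_contra hc
      rcases (not_lt.1 hc).eq_or_lt with h0 | h0
      · have := (sgn u hu).1 hu0
        rw [him, h0] at this; simp at this
      · linarith [(sgn u hu).1 hu0, (sgn v hv).2 h0]
    have hIm : ∀ t : ℝ, HasDerivAt (fun t => ((exp (γ t) + γ t) / d).im)
        (exp (γ t) + 1).im t := fun t =>
      (Complex.imCLM.hasFDerivAt.comp_hasDerivAt t (hG t))
    obtain ⟨c, hc, hc'⟩ := exists_hasDerivAt_eq_slope _ _ (zero_lt_one (α := ℝ))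
      (fun t _ => (hIm t).continuousAt.continuousWithinAt) (fun t _ => hIm t)
    have e0 : γ 0 = v := by simp [γ]
    have e1 : γ 1 = u := by simp [γ, hd]
    rw [e0, e1, h, sub_self, zero_div] at hc'
    have h1 : 0 < (γ c).im := by rw [him_γ]; nlinarith [hc.1, hc.2]
    have h2 : (γ c).im < π := by
      rw [him_γ]; rw [abs_lt] at hu hv; nlinarith [hc.1, hc.2, hu.2, hv.2]
    have h3 := Real.sin_pos_of_pos_of_lt_pi h1 h2
    simp only [Complex.add_im, Complex.exp_im, Complex.one_im, add_zero] at hc'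
    nlinarith [Real.exp_pos (γ c).re]

theorem strip_log {w : ℂ} (hw : w ∈ slitPlane) : |(Complex.log w).im| < π := by
  rw [Complex.log_im, abs_lt]
  exact ⟨neg_pi_lt_arg w, lt_of_le_of_ne (arg_le_pi w) (mem_slitPlane_iff_arg.1 hw).1⟩

theorem strip_exp {u : ℂ} (hu : |u.im| < π) : exp u ∈ slitPlane ∧ Complex.log (exp u) = u := by
  rw [abs_lt] at hu
  have h := Complex.log_exp hu.1 hu.2.le
  refine ⟨mem_slitPlane_iff_arg.2 ⟨?_, exp_ne_zero u⟩, h⟩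
  rw [← Complex.log_im, h]
  exact hu.2.ne

theorem slitPlane_add_log_injective {w₁ w₂ : ℂ} (h₁ : w₁ ∈ slitPlane) (h₂ : w₂ ∈ slitPlane)
    (h : w₁ + Complex.log w₁ = w₂ + Complex.log w₂) : w₁ = w₂ := by
  have e₁ := Complex.exp_log (slitPlane_ne_zero h₁)
  have e₂ := Complex.exp_log (slitPlane_ne_zero h₂)
  have := strip_injective (strip_log h₁) (strip_log h₂) (by rw [e₁, e₂, h])
  rw [← e₁, ← e₂, this]

theorem strip_deriv_ne_zero {u : ℂ} (hu : |u.im| < π) : exp u + 1 ≠ 0 := by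
  intro h
  have h1 : exp u = -1 := by linear_combination h
  have h2 := (strip_exp hu).1
  rw [h1, mem_slitPlane_iff] at h2
  norm_num at h2

theorem hasStrictDerivAt_exp_add (u : ℂ) :
    HasStrictDerivAt (fun u : ℂ => exp u + u) (exp u + 1) u :=
  (Complex.hasStrictDerivAt_exp u).add (hasStrictDerivAt_id u)

theorem isOpen_strip : IsOpen {u : ℂ | |u.im| < π} :=
  isOpen_lt (continuous_abs.comp continuous_im) continuous_const

theorem strip_surjective {Z : ℂ} (hZ : Z ∈ lambertDomain) :
    ∃ u : ℂ, |u.im| < π ∧ exp u + u = Z := by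
  set S : Set ℂ := {u : ℂ | |u.im| < π}
  set E : ℂ → ℂ := fun u => exp u + u with hE
  have hopen : IsOpen (E '' S) := by
    rw [isOpen_iff_mem_nhds]
    rintro _ ⟨u, hu, rfl⟩
    rw [← (hasStrictDerivAt_exp_add u).map_nhds_eq (strip_deriv_ne_zero hu)]
    exact image_mem_map (isOpen_strip.mem_nhds hu)
  have hsub : lambertDomain ⊆ E '' S := by
    refine isPreconnected_lambertDomain.subset_of_closure_inter_subset hopen ?_ ?_
    · exact ⟨E 0, by simp [hE, lambertDomain], 0, by simp [S, Real.pi_pos], rfl⟩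
    · rintro Y ⟨hYc, hYD⟩
      obtain ⟨y, hy, hyY⟩ := mem_closure_iff_seq_limit.1 hYc
      choose u hu hEu using hy
      obtain ⟨M, hM⟩ := (Metric.isBounded_range_of_tendsto y hyY).exists_norm_le
      have hM' : ∀ n, ‖E (u n)‖ ≤ M := fun n => by rw [hEu]; exact hM _ ⟨n, rfl⟩
      have hM0 : 0 ≤ M := (norm_nonneg _).trans (hM' 0)
      have hre : ∀ n, |(u n).re| ≤ 2 * M + 2 * π + 2 := by
        intro n
        have hn := hM' n
        have h1 : |(E (u n)).re| ≤ M := (abs_re_le_norm _).trans hn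
        have hun : |(u n).im| < π := hu n
        simp only [hE, Complex.add_re, Complex.exp_re] at h1
        rw [abs_le] at h1 ⊢
        have hpi := Real.pi_pos
        constructor
        · by_contra hc
          push Not at hc
          have h2 : Real.exp (u n).re ≤ 1 := Real.exp_le_one_iff.2 (by linarith)
          have h3 : Real.exp (u n).re * Real.cos (u n).im ≤ 1 := by
            nlinarith [Real.cos_le_one (u n).im, Real.exp_pos (u n).re]
          linarith [h1.1]
        · by_contra hc
          push Not at hc
          have h2 : ‖exp (u n)‖ ≤ M + (|(u n).re| + |(u n).im|) := by
            have : exp (u n) = E (u n) - u n := by simp [hE]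
            rw [this]
            exact (norm_sub_le _ _).trans (add_le_add hn (norm_le_abs_re_add_abs_im _))
          rw [Complex.norm_exp, abs_of_pos (by linarith : 0 < (u n).re)] at h2
          have h3 := Real.quadratic_le_exp_of_nonneg (by linarith : 0 ≤ (u n).re)
          nlinarith
      have hbd : Bornology.IsBounded (Set.range u) := by
        refine (isBounded_iff_forall_norm_le).2 ⟨2 * M + 2 * π + 2 + π, ?_⟩
        rintro _ ⟨n, rfl⟩
        have hun : |(u n).im| < π := hu n
        exact (norm_le_abs_re_add_abs_im _).trans (by linarith [hre n])
      obtain ⟨a, -, k, hk, ha⟩ := tendsto_subseq_of_bounded hbd (fun n => Set.mem_range_self n)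
      have hcE : Continuous E := by fun_prop
      have hEa : E a = Y := by
        refine tendsto_nhds_unique ((hcE.tendsto a).comp ha) ?_
        have : (E ∘ u ∘ k) = y ∘ k := by ext n; simp [hEu]
        rw [this]
        exact hyY.comp hk.tendsto_atTop
      have hle : |a.im| ≤ π :=
        le_of_tendsto' ((continuous_abs.comp continuous_im).tendsto a |>.comp ha)
          (fun n => (hu (k n)).le)
      rcases hle.lt_or_eq with hlt | heq
      · exact ⟨a, hlt, hEa⟩
      · exfalso
        have hcos : Real.cos a.im = -1 := by rw [← Real.cos_abs, heq, Real.cos_pi]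
        have hsin : Real.sin a.im = 0 := by
          rcases (abs_eq Real.pi_pos.le).1 heq with h | h <;> rw [h] <;> simp
        rw [← hEa] at hYD
        simp only [lambertDomain, hE, Set.mem_ofPred_eq, Complex.add_re, Complex.add_im,
          Complex.exp_re, Complex.exp_im, hcos, hsin, mul_zero, zero_add, heq, lt_irrefl,
          or_false] at hYD
        linarith [Real.add_one_le_exp a.re]
  obtain ⟨u, hu, h⟩ := hsub hZ
  exact ⟨u, hu, h⟩

theorem lambertW_existsUnique {z : LogSurface} (hz : z.log ∈ lambertDomain) :
    ∃! w : ℂ, w ∈ slitPlane ∧ w + Complex.log w = z.log := by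
  obtain ⟨u, hu, h⟩ := strip_surjective hz
  refine ⟨exp u, ⟨(strip_exp hu).1, by rw [(strip_exp hu).2, h]⟩, ?_⟩
  rintro w ⟨hw, hw'⟩
  refine slitPlane_add_log_injective hw (strip_exp hu).1 ?_
  rw [hw', (strip_exp hu).2, h]

theorem lambertW_spec {z : LogSurface} (hz : z.log ∈ lambertDomain) :
    lambertW z ∈ slitPlane ∧ lambertW z + Complex.log (lambertW z) = z.log := by
  have h := (lambertW_existsUnique hz).exists
  rw [lambertW, dif_pos h]
  exact h.choose_spec

theorem lambertW_eq {z : LogSurface} {w : ℂ} (hw : w ∈ slitPlane)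
    (h : w + Complex.log w = z.log) : lambertW z = w := by
  have h' : ∃ w : ℂ, w ∈ slitPlane ∧ w + Complex.log w = z.log := ⟨w, hw, h⟩
  rw [lambertW, dif_pos h']
  exact slitPlane_add_log_injective h'.choose_spec.1 hw (h'.choose_spec.2.trans h.symm)

/-- The functional equation `W e^W = z`. -/
theorem lambertW_mul_exp {z : LogSurface} (hz : z.log ∈ lambertDomain) :
    lambertW z * exp (lambertW z) = z.toComplex := by
  obtain ⟨h1, h2⟩ := lambertW_spec hz
  rw [← LogSurface.exp_log, ← h2, Complex.exp_add, Complex.exp_log (slitPlane_ne_zero h1), mul_comm]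

/-- `W` is analytic in the coordinate `log z`. -/
theorem lambertW_analyticOnNhd :
    AnalyticOnNhd ℂ (fun Z => lambertW (LogSurface.ofLog Z)) lambertDomain := by
  intro Z hZ
  obtain ⟨u, hu, rfl⟩ := strip_surjective hZ
  have hA : AnalyticAt ℂ (fun u : ℂ => exp u + u) u := by fun_prop
  have hd : deriv (fun u : ℂ => exp u + u) u ≠ 0 := by
    rw [(hasStrictDerivAt_exp_add u).hasDerivAt.deriv]; exact strip_deriv_ne_zero hu
  refine (analyticAt_comp_iff_of_deriv_ne_zero hA hd).1 ?_
  refine AnalyticAt.congr (f := exp) (by fun_prop) ?_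
  filter_upwards [isOpen_strip.mem_nhds hu] with v hv
  exact (lambertW_eq (strip_exp hv).1 (by simp [(strip_exp hv).2])).symm

/-- `W` continues the germ at `0` of the analytic solution of `y e^y = z`. -/
theorem lambertW_eq_germ {W₀ : ℂ → ℂ} (hW : AnalyticAt ℂ W₀ 0)
    (h : ∀ᶠ z in 𝓝 (0 : ℂ), W₀ z * exp (W₀ z) = z) :
    ∀ᶠ X : ℝ in atBot, ∀ θ : ℝ, |θ| ≤ π / 2 →
      lambertW (LogSurface.ofLog (X + θ * I)) = W₀ (exp (X + θ * I)) := by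
  have h0 : W₀ 0 = 0 := by simpa using h.self_of_nhds
  have hsmall : ∀ᶠ z in 𝓝 (0 : ℂ), ‖W₀ z‖ < 1 := by
    have := hW.continuousAt.norm
    rw [ContinuousAt, h0, norm_zero] at this
    exact this.eventually_lt_const one_pos
  obtain ⟨ε, hε, hball⟩ := Metric.eventually_nhds_iff_ball.1 (h.and hsmall)
  filter_upwards [Real.tendsto_exp_atBot.eventually_lt_const hε] with X hX θ hθ
  set Z : ℂ := X + θ * I with hZ
  have hmem : exp Z ∈ Metric.ball (0 : ℂ) ε := by
    simpa [hZ, Complex.norm_exp] using hX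
  obtain ⟨he, hs⟩ := hball _ hmem
  set w := W₀ (exp Z)
  have him : |(Z - w).im| < π := by
    have h1 : |w.im| < 1 := (abs_im_le_norm w).trans_lt hs
    have h2 : (Z - w).im = θ - w.im := by simp [hZ]
    rw [h2]
    rw [abs_lt] at h1 ⊢
    rw [abs_le] at hθ
    constructor <;> linarith [Real.pi_gt_three, h1.1, h1.2, hθ.1, hθ.2]
  have hw : w = exp (Z - w) := by
    rw [Complex.exp_sub, eq_div_iff (exp_ne_zero w), he]
  have hsl := strip_exp him
  rw [← hw] at hsl
  exact lambertW_eq hsl.1 (by rw [hsl.2]; simp)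

/-- The variant `ω(λ, x) = λ W(x / λ)` of the Lambert function, for `λ > 0`. -/
noncomputable def omega (lam : ℝ) (hlam : 0 < lam) (x : LogSurface) : ℂ :=
  lam * lambertW (x / LogSurface.ofPos lam hlam)

/-! ### The coefficients `V_n` -/

/-- `ℓ` represents the germ of analytic function at `0` with `ℓ(0) = 0`, `ℓ'(0) = 1` and
`ℓ(z) = W(-e^{-1 - z²/2}) + 1`, that is to say, with
`(ℓ(z) - 1) e^{ℓ(z) - 1} = -e^{-1 - z²/2}` near `0`. -/
def IsEllGerm (l : ℂ → ℂ) : Prop :=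
  AnalyticAt ℂ l 0 ∧ l 0 = 0 ∧ deriv l 0 = 1 ∧
    ∀ᶠ z in 𝓝 (0 : ℂ), (l z - 1) * exp (l z - 1) = -exp (-1 - z ^ 2 / 2)

theorem exists_isEllGerm : ∃ l, IsEllGerm l := by
  -- `f(y) = -2 (Log (1 - y) + y) = y² g(y)` with `g(0) = 1`
  set f : ℂ → ℂ := fun y => -2 * (Complex.log (1 - y) + y) with hf
  have hball : Metric.ball (0 : ℂ) 1 ∈ 𝓝 (0 : ℂ) := Metric.ball_mem_nhds _ one_pos
  have hslit : ∀ y ∈ Metric.ball (0 : ℂ) 1, 1 - y ∈ slitPlane := by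
    intro y hy
    have := mem_slitPlane_of_norm_lt_one (z := -y) (by simpa using hy)
    simpa [sub_eq_add_neg] using this
  have hfd : ∀ y ∈ Metric.ball (0 : ℂ) 1, HasDerivAt f (2 * y / (1 - y)) y := by
    intro y hy
    have h1 : HasDerivAt (fun y : ℂ => 1 - y) (-1) y := by
      simpa using (hasDerivAt_id y).const_sub 1
    have h2 := ((h1.clog (hslit y hy)).add (hasDerivAt_id y)).const_mul (-2 : ℂ)
    refine HasDerivAt.congr_deriv (f := f) h2 ?_
    have := slitPlane_ne_zero (hslit y hy)
    rw [eq_div_iff this, mul_assoc, add_mul, div_mul_cancel₀ _ this]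
    ring
  have hf0 : f 0 = 0 := by simp [hf]
  have hdf0 : deriv f 0 = 0 := by
    rw [(hfd 0 (Metric.mem_ball_self one_pos)).deriv]; simp
  set g : ℂ → ℂ := dslope (dslope f 0) 0 with hg
  have hgD : DifferentiableOn ℂ g (Metric.ball 0 1) := by
    rw [hg, differentiableOn_dslope hball, differentiableOn_dslope hball]
    exact fun y hy => (hfd y hy).differentiableAt.differentiableWithinAt
  have hfg : ∀ y, f y = y ^ 2 * g y := by
    intro y
    have e1 := sub_smul_dslope_of_zero hf0 y
    have e2 := sub_smul_dslope_of_zero (f := dslope f 0) (a := 0) (by rw [dslope_same, hdf0]) y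
    simp only [sub_zero, smul_eq_mul] at e1 e2
    rw [← e1, ← e2, pow_two, mul_assoc]
  have hgA : AnalyticAt ℂ g 0 := hgD.analyticAt hball
  have hg0 : g 0 = 1 := by
    have key : ∀ y ∈ Metric.ball (0 : ℂ) 1, y ≠ 0 → 2 / (1 - y) = 2 * g y + y * deriv g y := by
      intro y hy hy0
      have h1 : HasDerivAt g (deriv g y) y :=
        (hgD.differentiableAt (Metric.isOpen_ball.mem_nhds hy)).hasDerivAt
      have h2 : HasDerivAt f (2 * y * g y + y ^ 2 * deriv g y) y := by
        have := (hasDerivAt_pow 2 y).mul h1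
        rw [show f = fun y => y ^ 2 * g y from funext hfg]
        refine HasDerivAt.congr_deriv (f := fun y => y ^ 2 * g y) this ?_
        norm_num
      have h3 := (hfd y hy).unique h2
      have h4 := slitPlane_ne_zero (hslit y hy)
      apply mul_left_cancel₀ hy0
      linear_combination h3
    have t1 : Tendsto (fun y : ℂ => 2 / (1 - y)) (𝓝[≠] 0) (𝓝 2) := by
      have : ContinuousAt (fun y : ℂ => 2 / (1 - y)) 0 := by
        apply ContinuousAt.div <;> first | fun_prop | simp
      have := this.tendsto.mono_left (nhdsWithin_le_nhds (s := {0}ᶜ))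
      simpa using this
    have t2 : Tendsto (fun y : ℂ => 2 * g y + y * deriv g y) (𝓝[≠] 0) (𝓝 (2 * g 0)) := by
      have c1 : ContinuousAt (fun y : ℂ => 2 * g y + y * deriv g y) 0 :=
        (hgA.continuousAt.const_mul 2).add (continuousAt_id.mul hgA.deriv.continuousAt)
      have := c1.tendsto.mono_left (nhdsWithin_le_nhds (s := {0}ᶜ))
      simpa using this
    have hev : (fun y : ℂ => 2 / (1 - y)) =ᶠ[𝓝[≠] 0] fun y => 2 * g y + y * deriv g y := by
      filter_upwards [nhdsWithin_le_nhds hball, self_mem_nhdsWithin] with y hy hy0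
      exact key y hy hy0
    have := tendsto_nhds_unique (t1.congr' hev) t2
    linear_combination -(this / 2)
  -- a square root `s` of `g`, and the local inverse of `y s(y)`
  set s : ℂ → ℂ := fun y => exp (Complex.log (g y) / 2) with hs
  have hsA : AnalyticAt ℂ s 0 :=
    ((hgA.clog (by rw [hg0]; exact one_mem_slitPlane)).div_const).cexp
  have hs0 : s 0 = 1 := by simp [hs, hg0]
  set p : ℂ → ℂ := fun y => y * s y with hp
  have hpA : AnalyticAt ℂ p 0 := analyticAt_id.mul hsA
  have hp0 : p 0 = 0 := by simp [hp]
  have hdp : deriv p 0 = 1 := by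
    have := (hasDerivAt_id (0 : ℂ)).mul hsA.differentiableAt.hasDerivAt
    have h2 : HasDerivAt p (1 * s 0 + 0 * deriv s 0) 0 := this
    rw [h2.deriv, hs0]; simp
  have hdp' : deriv p 0 ≠ 0 := by rw [hdp]; exact one_ne_zero
  set l := hpA.hasStrictDerivAt.localInverse _ _ _ hdp' with hl
  have hlA : AnalyticAt ℂ l 0 := by
    have := hpA.analyticAt_localInverse hdp'
    rwa [hp0] at this
  have hl0 : l 0 = 0 := by
    have := (hpA.hasStrictDerivAt.eventually_left_inverse hdp').self_of_nhds
    rwa [hp0] at this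
  have hld : deriv l 0 = 1 := by
    have := (hpA.hasStrictDerivAt.to_localInverse hdp').hasDerivAt.deriv
    rw [hp0] at this
    exact this.trans (by rw [hdp, inv_one])
  refine ⟨l, hlA, hl0, hld, ?_⟩
  have hr : ∀ᶠ z in 𝓝 (0 : ℂ), p (l z) = z := by
    have := hpA.hasStrictDerivAt.eventually_right_inverse hdp'
    rwa [hp0] at this
  have hlt : Tendsto l (𝓝 0) (𝓝 0) := by simpa [hl0] using hlA.continuousAt.tendsto
  have hgne : ∀ᶠ y in 𝓝 (0 : ℂ), g y ≠ 0 :=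
    hgA.continuousAt.eventually_ne (by rw [hg0]; exact one_ne_zero)
  filter_upwards [hr, hlt.eventually hball, hlt.eventually hgne] with z hz hzb hzg
  have hsq : s (l z) ^ 2 = g (l z) := by
    simp only [hs]
    rw [← Complex.exp_nat_mul]
    rw [show ((2 : ℕ) : ℂ) * (Complex.log (g (l z)) / 2) = Complex.log (g (l z)) by push_cast; ring]
    exact Complex.exp_log hzg
  have hfz : f (l z) = z ^ 2 := by
    rw [hfg, ← hsq, ← mul_pow]
    exact congrArg (· ^ 2) hz
  have hlog : Complex.log (1 - l z) = -l z - z ^ 2 / 2 := by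
    simp only [hf] at hfz
    linear_combination -hfz / 2
  have h1 : 1 - l z = exp (-l z - z ^ 2 / 2) := by
    rw [← hlog, Complex.exp_log (slitPlane_ne_zero (hslit _ hzb))]
  have h2 : l z - 1 = -exp (-l z - z ^ 2 / 2) := by linear_combination -h1
  have h3 : exp (-l z - z ^ 2 / 2) * exp (l z - 1) = exp (-1 - z ^ 2 / 2) := by
    rw [← Complex.exp_add]; congr 1; ring
  rw [← h3, ← neg_mul, ← h2]

/-- The function `ℓ` (only its germ at `0` matters, and the germ is unique). -/
noncomputable def ell : ℂ → ℂ := Classical.choose exists_isEllGerm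

theorem isEllGerm_ell : IsEllGerm ell := Classical.choose_spec exists_isEllGerm

/-- `V(λ, σ) = e^{(λ/2) (ℓ(σ)² + σ² ℓ(σ) + σ⁴/4)} ℓ'(σ)`, near `σ = 0`. -/
noncomputable def V (lam : ℝ) (σ : ℂ) : ℂ :=
  exp (lam / 2 * (ell σ ^ 2 + σ ^ 2 * ell σ + σ ^ 4 / 4)) * deriv ell σ

/-- The `n`th Taylor coefficient `V_n = V_n(λ)` of `σ ↦ V(λ, σ)` at `σ = 0`. -/
noncomputable def Vcoeff (lam : ℝ) (n : ℕ) : ℂ := iteratedDeriv n (V lam) 0 / (n)!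

/-! ### The solution `h` at infinity -/

/-- The integral `∫_C Φ(t) dt/t` over the Hankel contour `C` on the Riemann surface of the
logarithm: `t` comes from infinity along the negative axis with `arg t = -π` as far as `|t| = 1`,
runs once through the unit circle in the positive direction, and goes back to infinity along the
negative axis with `arg t = π`. It is written in the coordinate `τ = log t`, for which
`dt/t = dτ`. -/
noncomputable def hankelIntegral (Φ : LogSurface → ℂ) : ℂ :=
  -(∫ σ in Set.Ioi (0 : ℝ), Φ (LogSurface.ofLog (σ - π * I)))
    + I * (∫ θ in (-π)..π, Φ (LogSurface.ofLog (θ * I)))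
    + ∫ σ in Set.Ioi (0 : ℝ), Φ (LogSurface.ofLog (σ + π * I))

/-- `κ = -2π / ln q`. -/
noncomputable def kappa (q : ℝ) : ℝ := -(2 * π) / Real.log q

/-- `h(x) = (√κ / (2πi)) ∫_C e^{t - (1 / (2 ln q)) log² (√q t / x)} dt/t` over the Hankel
contour `C`. -/
noncomputable def hSol (q : ℝ) (hq : 0 < q) (x : LogSurface) : ℂ :=
  (Real.sqrt (kappa q) : ℂ) / (2 * π * I) *
    hankelIntegral fun t =>
      exp (t.toComplex - 1 / (2 * (Real.log q : ℂ)) *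
        (LogSurface.ofPos (Real.sqrt q) (Real.sqrt_pos.2 hq) * t / x).log ^ 2)

theorem neg_one_div_log_pos {q : ℝ} (hq0 : 0 < q) (hq1 : q < 1) : 0 < -1 / Real.log q :=
  div_pos_of_neg_of_neg (by norm_num) (Real.log_neg hq0 hq1)

/-- `ω̃(q, x) = ω(λ, q^{-3/2} x) = λ W(q^{-3/2} x / λ)` with `λ = -1 / ln q`. -/
noncomputable def omegaTilde (q : ℝ) (hq0 : 0 < q) (hq1 : q < 1) (x : LogSurface) : ℂ :=
  omega (-1 / Real.log q) (neg_one_div_log_pos hq0 hq1)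
    (LogSurface.ofPos (q ^ (-(3 / 2) : ℝ)) (Real.rpow_pos_of_pos hq0 _) * x)

end Pantograph

open Pantograph

/-!
The expansion is a saddle point expansion, made uniform in `arg x` by letting the contour turn with
the saddle point.

With `τ = log t`, `lam = -1 / ln q` and `A = log x - (ln q) / 2` the integrand of `h` is
`exp (e^τ + (lam/2) (τ - A)²)`. Put `ω = ω̃(q, x)`; the Lambert equation for `ω` reads
`ω + lam Log ω = lam A + 1`, and the substitution `τ = Log ω + s` turns the integrand into
`e^{(1-ω)²/(2 lam) + ω} exp (ω (e^s - s - 1) + s + lam s²/2)` (`exp_saddle_shift`). The first factor,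
with the constants in front of the integral, is the prefactor of the expansion (`hSol_prefactor`).
There remains a saddle point at `s = 0` with the large parameter `ω`, where `|ω| → ∞`, and, with
`κ` as small as desired, `Re ω ≥ -κ |ω|` for `|x|` large, whatever `arg x` is
(`eventually_omegaTilde`). The argument `θ` of `ω` may slightly exceed `π/2` in absolute value.

* Near the saddle point, `s = log (1 - ℓ(z))` makes the phase `e^s - s - 1` equal to `z²/2` and the
  integrand equal to `-e^{ωz²/2} V(z) dz` (`eventually_saddleIntegrand_saddleCoord`). On
  `z = -i e^{-iθ/2} η` with `|η| ≤ δ` the exponential is the Gaussian `e^{-|ω| η²/2}`, and the Taylor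
  expansion of `V` gives the asserted series (`exists_laplace_bound`).
* The two ends of this arc are joined to the ends of the contour by following the rays
  `s = ±i e^{-iθ/2} y` until they meet the horizontal lines `Im s = ±π - θ`, on which `ω e^s` is a
  negative real number. On both rays `Re (e^{iθ} (e^s - s - 1))` is decreasing
  (`antitoneOn_re_phase_ray`), and it still decreases on the horizontal lines, so that all of this
  contributes `O(e^{-c|ω|})` (`exists_upper_bound`, `exists_lower_bound`).

No contour has to be deformed explicitly: the integrand is entire, hence has a primitive `P` on `ℂ`,
and each piece of the contour is an increment of `P` between two points
(`tendsto_hankelIntegral`, `exists_saddle_expansion`).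
-/

namespace Pantograph

/-! ### Gaussian moments and Laplace integrals -/

theorem integrable_pow_mul_gaussian {r : ℝ} (hr : 0 < r) (k : ℕ) :
    Integrable fun y : ℝ => y ^ k * Real.exp (-(r * y ^ 2 / 2)) := by
  have h := integrable_rpow_mul_exp_neg_mul_sq (b := r / 2) (by positivity) (s := k)
    (by linarith [(Nat.cast_nonneg k : (0 : ℝ) ≤ k)])
  refine h.congr (Eventually.of_forall fun y => ?_)
  simp only [Real.rpow_natCast]
  congr 2
  ring

theorem integrable_abs_pow_mul_gaussian {r : ℝ} (hr : 0 < r) (k : ℕ) :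
    Integrable fun y : ℝ => |y| ^ k * Real.exp (-(r * y ^ 2 / 2)) := by
  refine (integrable_pow_mul_gaussian hr k).norm.congr (Eventually.of_forall fun y => ?_)
  simp

theorem integral_odd_pow_mul_gaussian (r : ℝ) (n : ℕ) :
    ∫ y : ℝ, y ^ (2 * n + 1) * Real.exp (-(r * y ^ 2 / 2)) = 0 := by
  have h := integral_neg_eq_self
    (fun y : ℝ => y ^ (2 * n + 1) * Real.exp (-(r * y ^ 2 / 2))) volume
  have e : ∀ y : ℝ, (-y) ^ (2 * n + 1) * Real.exp (-(r * (-y) ^ 2 / 2)) =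
      -(y ^ (2 * n + 1) * Real.exp (-(r * y ^ 2 / 2))) := fun y => by
    rw [Odd.neg_pow ⟨n, rfl⟩, neg_sq]; ring
  simp only [e, integral_neg] at h
  linarith

theorem integral_even_pow_mul_gaussian {r : ℝ} (hr : 0 < r) (n : ℕ) :
    ∫ y : ℝ, y ^ (2 * n) * Real.exp (-(r * y ^ 2 / 2)) =
      √(2 * π / r) * ((2 * n)! / (2 ^ n * n ! * r ^ n)) := by
  induction n with
  | zero =>
    have h := integral_gaussian (r / 2)
    simp only [mul_zero, pow_zero, one_mul, Nat.factorial_zero, Nat.cast_one, mul_one, div_one]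
    rw [show 2 * π / r = π / (r / 2) by field_simp, ← h]
    congr 1; ext y; congr 1; ring
  | succ n ih =>
    have hd : ∀ y : ℝ, HasDerivAt (fun y : ℝ => y ^ (2 * n + 1) * Real.exp (-(r * y ^ 2 / 2)))
        ((2 * n + 1) * (y ^ (2 * n) * Real.exp (-(r * y ^ 2 / 2))) -
          r * (y ^ (2 * (n + 1)) * Real.exp (-(r * y ^ 2 / 2)))) y := by
      intro y
      have h1 : HasDerivAt (fun y : ℝ => -(r * y ^ 2 / 2)) (-(r * y)) y := by
        have := ((((hasDerivAt_pow 2 y).const_mul r).div_const 2).neg)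
        refine this.congr_deriv ?_
        simp; ring
      refine ((hasDerivAt_pow (2 * n + 1) y).mul h1.exp).congr_deriv ?_
      push_cast
      ring
    have i1 := (integrable_pow_mul_gaussian hr (2 * n)).const_mul (2 * n + 1 : ℝ)
    have i2 := (integrable_pow_mul_gaussian hr (2 * (n + 1))).const_mul r
    have h := integral_eq_zero_of_hasDerivAt_of_integrable hd (i1.sub i2)
      (integrable_pow_mul_gaussian hr (2 * n + 1))
    rw [integral_sub i1 i2, integral_const_mul, integral_const_mul, ih] at h
    have h2 : r * ∫ y : ℝ, y ^ (2 * (n + 1)) * Real.exp (-(r * y ^ 2 / 2)) =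
      (2 * n + 1) * (√(2 * π / r) * ((2 * n)! / (2 ^ n * n ! * r ^ n))) := by linarith
    apply mul_left_cancel₀ hr.ne'
    rw [h2, show 2 * (n + 1) = 2 * n + 1 + 1 by ring, Nat.factorial_succ, Nat.factorial_succ,
      Nat.factorial_succ]
    push_cast
    field_simp
    ring

/-- Exponential decay beats any power, in the form used to discard exponentially small terms. -/
theorem exists_exp_neg_mul_le {c : ℝ} (hc : 0 < c) (N : ℕ) :
    ∃ C : ℝ, 0 ≤ C ∧ ∀ r : ℝ, 1 ≤ r → Real.exp (-(r * c)) ≤ C / (r ^ (N + 1) * √r) := by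
  refine ⟨(N + 2)! / c ^ (N + 2), by positivity, fun r hr => ?_⟩
  have hr0 : 0 < r := by linarith
  have h1 := Real.pow_div_factorial_le_exp (r * c) (by positivity) (N + 2)
  have h2 : √r ≤ r := by
    rw [Real.sqrt_le_left hr0.le]; nlinarith
  have h3 : r ^ (N + 1) * √r ≤ r ^ (N + 2) := by
    rw [pow_succ r (N + 1)]; gcongr
  rw [Real.exp_neg]
  calc (Real.exp (r * c))⁻¹ ≤ ((r * c) ^ (N + 2) / (N + 2)!)⁻¹ := by gcongr
    _ = (N + 2)! / c ^ (N + 2) / r ^ (N + 2) := by rw [mul_pow]; field_simp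
    _ ≤ (N + 2)! / c ^ (N + 2) / (r ^ (N + 1) * √r) := by gcongr

/-- A Gaussian moment over `[-δ, δ]` differs from the one over `ℝ` by an exponentially small
amount. -/
theorem abs_gaussian_moment_tail_le {δ r : ℝ} (hδ : 0 < δ) (hr : 1 ≤ r) (k : ℕ) :
    |(∫ y in (-δ)..δ, y ^ k * Real.exp (-(r * y ^ 2 / 2))) -
        ∫ y : ℝ, y ^ k * Real.exp (-(r * y ^ 2 / 2))| ≤
      Real.exp (-((r - 1) * (δ ^ 2 / 2))) * ∫ y : ℝ, |y| ^ k * Real.exp (-(1 * y ^ 2 / 2)) := by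
  have hi := integrable_pow_mul_gaussian (by linarith : 0 < r) k
  have hj := integrable_abs_pow_mul_gaussian one_pos k
  have hs := integral_add_compl (measurableSet_Ioc (a := -δ) (b := δ)) hi
  rw [intervalIntegral.integral_of_le (by linarith), ← hs, sub_add_cancel_left, abs_neg,
    ← Real.norm_eq_abs, ← integral_const_mul]
  refine (norm_integral_le_integral_norm _).trans ?_
  refine (setIntegral_mono_on hi.norm.integrableOn (hj.const_mul _).integrableOn
    measurableSet_Ioc.compl ?_).trans
    (setIntegral_le_integral (hj.const_mul _) (Eventually.of_forall fun y => by positivity))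
  intro y hy
  have hy2 : δ ^ 2 ≤ y ^ 2 := by
    by_contra! h
    exact hy (Set.Ioo_subset_Ioc_self (abs_lt.1 (abs_lt_of_sq_lt_sq h hδ.le)))
  rw [norm_mul, norm_pow, Real.norm_eq_abs, Real.norm_eq_abs, Real.abs_exp, mul_left_comm,
    ← Real.exp_add]
  gcongr
  nlinarith [mul_nonneg (sub_nonneg.2 hr) (sub_nonneg.2 hy2)]

/-- Laplace's method for a function with a Taylor expansion of order `2N + 2` at the origin,
integrated against a Gaussian along a segment of arbitrary direction `u`; the estimate is uniform
in `u`. -/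
theorem exists_laplace_bound {f : ℂ → ℂ} {a : ℕ → ℂ} {δ M : ℝ} (hδ : 0 < δ) (N : ℕ)
    (hf : ContinuousOn f (Metric.closedBall 0 δ))
    (hfa : ∀ z ∈ Metric.closedBall (0 : ℂ) δ,
      ‖f z - ∑ k ∈ Finset.range (2 * N + 2), a k * z ^ k‖ ≤ M * ‖z‖ ^ (2 * N + 2)) :
    ∃ C : ℝ, ∀ r : ℝ, 1 ≤ r → ∀ u : ℂ, ‖u‖ = 1 →
      ‖(∫ y in (-δ)..δ, (Real.exp (-(r * y ^ 2 / 2)) : ℂ) * f (u * y)) -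
          √(2 * π / r) * ∑ n ∈ Finset.range (N + 1),
            ((2 * n)! : ℂ) * a (2 * n) / (2 ^ n * (n ! : ℂ)) * (u ^ 2 / r) ^ n‖ ≤
        C / (r ^ (N + 1) * √r) := by
  obtain ⟨C₀, hC₀, hexp⟩ := exists_exp_neg_mul_le (c := δ ^ 2 / 2) (by positivity) N
  set J : ℕ → ℝ := fun k => ∫ y : ℝ, |y| ^ k * Real.exp (-(1 * y ^ 2 / 2)) with hJ
  refine ⟨M * (√(2 * π) * ((2 * (N + 1))! / (2 ^ (N + 1) * (N + 1)!))) +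
    (∑ k ∈ Finset.range (2 * N + 2), ‖a k‖ * J k) * Real.exp (δ ^ 2 / 2) * C₀, ?_⟩
  intro r hr u hu
  have hr0 : 0 < r := by linarith
  set g : ℝ → ℝ := fun y => Real.exp (-(r * y ^ 2 / 2)) with hg
  have hM : 0 ≤ M := by
    have := (norm_nonneg _).trans (hfa (δ : ℂ) (by simp [abs_of_pos hδ]))
    simp only [norm_real, Real.norm_eq_abs, abs_of_pos hδ] at this
    exact nonneg_of_mul_nonneg_left this (by positivity)
  have hmem : ∀ y ∈ Set.uIcc (-δ) δ, u * (y : ℂ) ∈ Metric.closedBall (0 : ℂ) δ := by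
    intro y hy
    rw [Set.uIcc_of_le (by linarith)] at hy
    simpa [hu] using abs_le.2 ⟨hy.1, hy.2⟩
  have hgc : Continuous fun y : ℝ => (g y : ℂ) := by fun_prop
  have hfi : IntervalIntegrable (fun y : ℝ => (g y : ℂ) * f (u * y)) volume (-δ) δ := by
    refine ContinuousOn.intervalIntegrable (hgc.continuousOn.mul (hf.comp ?_ hmem))
    fun_prop
  have hpi : IntervalIntegrable (fun y : ℝ => (g y : ℂ) *
      ∑ k ∈ Finset.range (2 * N + 2), a k * (u * y) ^ k) volume (-δ) δ :=
    Continuous.intervalIntegrable (by fun_prop) _ _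
  -- the Taylor polynomial
  have hpoly : (∫ y in (-δ)..δ, (g y : ℂ) * ∑ k ∈ Finset.range (2 * N + 2), a k * (u * y) ^ k) =
      ∑ k ∈ Finset.range (2 * N + 2), a k * u ^ k * ((∫ y in (-δ)..δ, y ^ k * g y : ℝ) : ℂ) := by
    simp_rw [Finset.mul_sum]
    rw [intervalIntegral.integral_finsetSum
      (fun k _ => Continuous.intervalIntegrable (by fun_prop) _ _)]
    refine Finset.sum_congr rfl fun k _ => ?_
    rw [← intervalIntegral.integral_ofReal, ← intervalIntegral.integral_const_mul]
    congr 1; ext y; push_cast; ring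
  have hmain : (√(2 * π / r) : ℂ) * ∑ n ∈ Finset.range (N + 1),
        ((2 * n)! : ℂ) * a (2 * n) / (2 ^ n * (n ! : ℂ)) * (u ^ 2 / r) ^ n =
      ∑ k ∈ Finset.range (2 * N + 2), a k * u ^ k * ((∫ y : ℝ, y ^ k * g y : ℝ) : ℂ) := by
    have hsplit : ∀ (F : ℕ → ℂ) (m : ℕ), ∑ k ∈ Finset.range (2 * m), F k =
        ∑ n ∈ Finset.range m, (F (2 * n) + F (2 * n + 1)) := by
      intro F m
      induction m with
      | zero => simp
      | succ m ih =>
        rw [show 2 * (m + 1) = 2 * m + 1 + 1 by ring, Finset.sum_range_succ, Finset.sum_range_succ,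
          ih, Finset.sum_range_succ, add_assoc]
    rw [show 2 * N + 2 = 2 * (N + 1) by ring, hsplit, Finset.mul_sum]
    refine Finset.sum_congr rfl fun n _ => ?_
    rw [integral_odd_pow_mul_gaussian, integral_even_pow_mul_gaussian hr0]
    have : (r : ℂ) ≠ 0 := by exact_mod_cast hr0.ne'
    push_cast
    rw [div_pow, ← pow_mul]
    field_simp
    ring
  have h1 : ‖(∫ y in (-δ)..δ, (g y : ℂ) * f (u * y)) - ∫ y in (-δ)..δ, (g y : ℂ) *
      ∑ k ∈ Finset.range (2 * N + 2), a k * (u * y) ^ k‖ ≤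
      M * (√(2 * π) * ((2 * (N + 1))! / (2 ^ (N + 1) * (N + 1)!))) / (r ^ (N + 1) * √r) := by
    rw [← intervalIntegral.integral_sub hfi hpi]
    have hi := (integrable_pow_mul_gaussian hr0 (2 * (N + 1))).const_mul M
    calc _ ≤ ∫ y in (-δ)..δ, M * (y ^ (2 * (N + 1)) * g y) := by
          refine intervalIntegral.norm_integral_le_of_norm_le (by linarith)
            (Eventually.of_forall fun y hy => ?_) hi.intervalIntegrable
          rw [← mul_sub, norm_mul]
          have := hfa _ (hmem y (Set.Ioc_subset_Icc_self.trans Set.Icc_subset_uIcc hy))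
          rw [norm_mul, hu, one_mul, norm_real, Real.norm_eq_abs,
            Even.pow_abs ⟨N + 1, by ring⟩] at this
          rw [norm_real, Real.norm_eq_abs, abs_of_pos (Real.exp_pos _)]
          calc g y * _ ≤ g y * (M * y ^ (2 * N + 2)) :=
                mul_le_mul_of_nonneg_left this (Real.exp_pos _).le
            _ = _ := by ring
      _ ≤ ∫ y : ℝ, M * (y ^ (2 * (N + 1)) * g y) := by
          rw [intervalIntegral.integral_of_le (by linarith)]
          refine setIntegral_le_integral hi (Eventually.of_forall fun y => ?_)
          have : 0 ≤ y ^ (2 * (N + 1)) := Even.pow_nonneg ⟨N + 1, by ring⟩ y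
          have := Real.exp_pos (-(r * y ^ 2 / 2))
          simp only [Pi.zero_apply]
          positivity
      _ = _ := by
          rw [integral_const_mul, integral_even_pow_mul_gaussian hr0,
            Real.sqrt_div (by positivity)]
          field_simp
  have h2 : ‖∑ k ∈ Finset.range (2 * N + 2), a k * u ^ k * ((∫ y in (-δ)..δ, y ^ k * g y : ℝ) : ℂ) -
      ∑ k ∈ Finset.range (2 * N + 2), a k * u ^ k * ((∫ y : ℝ, y ^ k * g y : ℝ) : ℂ)‖ ≤
      (∑ k ∈ Finset.range (2 * N + 2), ‖a k‖ * J k) * Real.exp (δ ^ 2 / 2) * C₀ /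
        (r ^ (N + 1) * √r) := by
    rw [← Finset.sum_sub_distrib, mul_div_assoc, Finset.sum_mul, Finset.sum_mul]
    refine norm_sum_le_of_le _ fun k _ => ?_
    rw [← mul_sub, norm_mul, norm_mul, norm_pow, hu, one_pow, mul_one, ← ofReal_sub, norm_real,
      Real.norm_eq_abs]
    have hJ0 : 0 ≤ J k := integral_nonneg fun y => by positivity
    calc ‖a k‖ * _ ≤ ‖a k‖ * (Real.exp (-((r - 1) * (δ ^ 2 / 2))) * J k) := by
          gcongr
          exact abs_gaussian_moment_tail_le hδ hr k
      _ = ‖a k‖ * J k * Real.exp (δ ^ 2 / 2) * Real.exp (-(r * (δ ^ 2 / 2))) := by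
          rw [show -((r - 1) * (δ ^ 2 / 2)) = δ ^ 2 / 2 + -(r * (δ ^ 2 / 2)) by ring, Real.exp_add]
          ring
      _ ≤ _ := by gcongr; exact hexp r hr
  rw [hmain, add_div]
  rw [hpoly] at h1
  calc _ = _ := congrArg norm (sub_add_sub_cancel _ _ _).symm
    _ ≤ _ := (norm_add_le _ _).trans (add_le_add h1 h2)

/-! ### Descent along a ray and a horizontal half-line -/

/-- The phase `e^s - s - 1`, whose saddle point at `s = 0` dominates the integral. -/
noncomputable def phase (s : ℂ) : ℂ := exp s - s - 1

/-- The integrand of `h` in the coordinate `s = log t - Log ω̃` centred at the saddle point, up to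
a factor that does not depend on `s`. -/
noncomputable def saddleIntegrand (lam : ℝ) (ω s : ℂ) : ℂ :=
  exp (ω * phase s + s + lam * s ^ 2 / 2)

/-- The direction `i e^{-iθ/2}` of steepest descent at the saddle point, for `θ = arg ω`. -/
noncomputable def descentDir (ω : ℂ) : ℂ := I * exp (-(ω.arg / 2 : ℝ) * I)

theorem norm_descentDir (ω : ℂ) : ‖descentDir ω‖ = 1 := by
  rw [descentDir, norm_mul, norm_I, one_mul, ← ofReal_neg, norm_exp_ofReal_mul_I]

theorem _root_.HasDerivAt.comp_real_path {P : ℂ → ℂ} {P' : ℂ} {γ : ℝ → ℂ} {γ' : ℂ} {t : ℝ}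
    (hP : HasDerivAt P P' (γ t)) (hγ : HasDerivAt γ γ' t) :
    HasDerivAt (fun t => P (γ t)) (P' * γ') t := by
  simpa [mul_comm, Function.comp_def] using hP.scomp t hγ

/-- The size of the integrand is governed by the phase rotated by `e^{iθ}`, for `θ = arg ω`; the
term `lam s²/2` only matters through `Re s`. -/
theorem norm_saddleIntegrand_le {lam : ℝ} (hlam : 0 < lam) (ω s : ℂ) :
    ‖saddleIntegrand lam ω s‖ ≤
      Real.exp (‖ω‖ * (exp (ω.arg * I) * phase s).re + s.re + lam * s.re ^ 2 / 2) := by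
  rw [saddleIntegrand, norm_exp]
  refine Real.exp_le_exp.2 ?_
  have h1 : (ω * phase s).re = ‖ω‖ * (exp (ω.arg * I) * phase s).re := by
    rw [← re_ofReal_mul, ← mul_assoc, norm_mul_exp_arg_mul_I]
  have h2 : ((lam : ℂ) * s ^ 2 / 2).re = lam * (s.re ^ 2 - s.im ^ 2) / 2 := by
    rw [mul_div_right_comm, ← ofReal_ofNat, ← ofReal_div, re_ofReal_mul, sq, mul_re]; ring
  rw [add_re, add_re, h1, h2]
  nlinarith [mul_nonneg hlam.le (sq_nonneg s.im)]

/-- `Re (e^{2iα} (e^s - s - 1))` at the point `s = i e^{-iα} y`. -/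
theorem re_phase_ray (α y : ℝ) :
    (exp ((2 * α : ℝ) * I) * phase (I * exp (-α * I) * y)).re =
      Real.exp (y * Real.sin α) * Real.cos (2 * α + y * Real.cos α) + y * Real.sin α -
        Real.cos (2 * α) := by
  have e1 : I * exp (-α * I) * y = (y * Real.sin α : ℝ) + (y * Real.cos α : ℝ) * I := by
    rw [exp_mul_I, ← ofReal_neg, ← ofReal_cos, ← ofReal_sin, Real.cos_neg, Real.sin_neg]
    push_cast
    linear_combination (-(y : ℂ) * Complex.sin α) * I_sq
  have e2 : exp ((2 * α : ℝ) * I) * exp (I * exp (-α * I) * y) =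
      exp ((y * Real.sin α : ℝ) + (2 * α + y * Real.cos α : ℝ) * I) := by
    rw [← Complex.exp_add, e1]; congr 1; push_cast; ring
  have e3 : exp ((2 * α : ℝ) * I) * (I * exp (-α * I) * y) = y * (I * exp (α * I)) := by
    rw [show ((2 * α : ℝ) : ℂ) * I = α * I + α * I by push_cast; ring, Complex.exp_add]
    have : exp (α * I) * exp (-α * I) = 1 := by rw [← Complex.exp_add]; simp
    linear_combination (exp (α * I) * I * y) * this
  rw [phase, mul_sub, mul_sub, e2, e3, mul_one, sub_re, sub_re, re_ofReal_mul, I_mul_re,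
    exp_ofReal_mul_I_im, exp_ofReal_mul_I_re, exp_re]
  simp [-ofReal_sin, -ofReal_cos]

/-- `Re (e^{2iα} (e^s - s - 1))` at the point `s = x + i (π - 2α)`. -/
theorem re_phase_horizontal (α x : ℝ) :
    (exp ((2 * α : ℝ) * I) * phase (x + (π - 2 * α : ℝ) * I)).re =
      -Real.exp x - x * Real.cos (2 * α) + (π - 2 * α) * Real.sin (2 * α) - Real.cos (2 * α) := by
  have e2 : exp ((2 * α : ℝ) * I) * exp (x + (π - 2 * α : ℝ) * I) = ((-Real.exp x : ℝ) : ℂ) := by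
    rw [← Complex.exp_add, show ((2 * α : ℝ) : ℂ) * I + (x + (π - 2 * α : ℝ) * I) = x + π * I by
      push_cast; ring, Complex.exp_add, exp_pi_mul_I]
    push_cast; ring
  rw [phase, mul_sub, mul_sub, e2, mul_one, sub_re, sub_re, ofReal_re, mul_re, exp_ofReal_mul_I_im,
    exp_ofReal_mul_I_re]
  simp
  ring

/-- The real part of the rotated phase decreases along the ray of steepest descent, all the way to
the horizontal line `Im s = π - 2α`: its derivative at `s = i e^{-iα} y` is
`sin α - e^{y sin α} sin (α + y cos α)`, where `α + y cos α` stays in `[α, π - α]`. -/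
theorem antitoneOn_re_phase_ray {α : ℝ} (hα : |α| ≤ π / 3) :
    AntitoneOn (fun y : ℝ => (exp ((2 * α : ℝ) * I) * phase (I * exp (-α * I) * y)).re)
      (Set.Icc 0 ((π - 2 * α) / Real.cos α)) := by
  simp only [re_phase_ray]
  have hpi := Real.pi_pos
  obtain ⟨h1, h2⟩ := abs_le.1 hα
  have hcos : 0 < Real.cos α := Real.cos_pos_of_mem_Ioo ⟨by linarith, by linarith⟩
  have hd : ∀ y : ℝ, HasDerivAt (fun y : ℝ => Real.exp (y * Real.sin α) *
      Real.cos (2 * α + y * Real.cos α) + y * Real.sin α - Real.cos (2 * α))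
      (Real.sin α - Real.exp (y * Real.sin α) * Real.sin (α + y * Real.cos α)) y := by
    intro y
    have a1 : HasDerivAt (fun y : ℝ => y * Real.sin α) (Real.sin α) y := by
      simpa using (hasDerivAt_id y).mul_const (Real.sin α)
    have a2 : HasDerivAt (fun y : ℝ => 2 * α + y * Real.cos α) (Real.cos α) y := by
      simpa using ((hasDerivAt_id y).mul_const (Real.cos α)).const_add (2 * α)
    refine (((a1.exp.mul a2.cos).add a1).sub_const _).congr_deriv ?_
    have := Real.sin_sub (2 * α + y * Real.cos α) α
    rw [show 2 * α + y * Real.cos α - α = α + y * Real.cos α by ring] at this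
    rw [this]
    ring
  refine antitoneOn_of_deriv_nonpos (convex_Icc _ _)
    (fun y _ => (hd y).continuousAt.continuousWithinAt)
    (fun y _ => (hd y).differentiableAt.differentiableWithinAt) fun y hy => ?_
  rw [(hd y).deriv]
  rw [interior_Icc, Set.mem_Ioo, lt_div_iff₀ hcos] at hy
  have hyc : 0 < y * Real.cos α := mul_pos hy.1 hcos
  -- `sin ≥ sin α` on `[α, π - α]`
  have hsin : Real.sin α ≤ Real.sin (α + y * Real.cos α) := by
    have hs := Real.sin_sub_sin (α + y * Real.cos α) α
    have p1 : 0 ≤ Real.sin ((α + y * Real.cos α - α) / 2) :=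
      Real.sin_nonneg_of_nonneg_of_le_pi (by linarith) (by linarith)
    have p2 : 0 ≤ Real.cos ((α + y * Real.cos α + α) / 2) :=
      Real.cos_nonneg_of_mem_Icc ⟨by linarith, by linarith⟩
    nlinarith [mul_nonneg p1 p2]
  rcases le_total 0 α with h0 | h0
  · have s0 : 0 ≤ Real.sin α := Real.sin_nonneg_of_nonneg_of_le_pi h0 (by linarith)
    have : 1 ≤ Real.exp (y * Real.sin α) := Real.one_le_exp (mul_nonneg hy.1.le s0)
    nlinarith
  · have s0 : Real.sin α ≤ 0 := Real.sin_nonpos_of_nonpos_of_neg_pi_le h0 (by linarith)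
    have : Real.exp (y * Real.sin α) ≤ 1 :=
      Real.exp_le_one_iff.2 (mul_nonpos_of_nonneg_of_nonpos hy.1.le s0)
    nlinarith [Real.exp_pos (y * Real.sin α)]

/-- The double exponential decay along horizontal lines absorbs the factor `e^{s + lam s²/2}`. -/
theorem exists_horizontal_majorant {lam : ℝ} (hlam : 0 < lam) :
    ∃ C : ℝ, ∀ x : ℝ, -11 ≤ x → -(Real.exp x / 2) + x + lam * x ^ 2 / 2 ≤ C - x := by
  refine ⟨6 * lam ^ 2 + 25 + 61 * lam, fun x hx => ?_⟩
  rcases le_total x 0 with h | h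
  · have := Real.exp_pos x
    have : x ^ 2 ≤ 121 := by nlinarith
    nlinarith [mul_le_mul_of_nonneg_left this hlam.le]
  · have h4 := Real.pow_div_factorial_le_exp x h 4
    norm_num [Nat.factorial] at h4
    nlinarith [sq_nonneg (x ^ 2 - 24 * lam), sq_nonneg (x ^ 2 - 48), sq_nonneg (x - 1)]

theorem cos_arg_of_le {ω : ℂ} {κ : ℝ} (hω : 1 ≤ ‖ω‖) (h : -κ * ‖ω‖ ≤ ω.re) :
    -κ ≤ Real.cos ω.arg := by
  have h0 : ω ≠ 0 := by rintro rfl; norm_num at hω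
  rw [cos_arg h0, le_div_iff₀ (by linarith)]
  exact h

/-- The upper half of the contour: from a point of the ray of steepest descent, the ray is
followed to the line `Im s = π - arg ω` and then this line to the right. On all of it the
integrand is `O(e^{-c|ω|})`. The constant `11` bounds the length of the ray; the line is then met at
`Re s ≥ -11`, where the hypothesis on `Re ω` makes the phase decrease to the right. -/
theorem exists_upper_bound {lam : ℝ} (hlam : 0 < lam) {δ c : ℝ} (hδ : 0 < δ)
    (hδ1 : δ < 1) :
    ∃ C : ℝ, ∀ ω : ℂ, 1 ≤ ‖ω‖ → -(Real.exp (-11) / 2) * ‖ω‖ ≤ ω.re →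
      (exp (ω.arg * I) * phase (descentDir ω * δ)).re ≤ -c →
      ∀ P : ℂ → ℂ, (∀ s, HasDerivAt P (saddleIntegrand lam ω s) s) →
      ∀ R : ℝ, 11 ≤ R →
        ‖P (R + (π - ω.arg : ℝ) * I) - P (descentDir ω * δ)‖ ≤ C * Real.exp (-(‖ω‖ * c)) := by
  obtain ⟨C₁, hC₁⟩ := exists_horizontal_majorant hlam
  refine ⟨Real.exp (C₁ + Real.exp 11 / 2) * Real.exp 11 + Real.exp (11 + 61 * lam) * 11, ?_⟩
  intro ω hω hre hpδ P hP R hR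
  have hcosθ := cos_arg_of_le hω hre
  obtain ⟨α, hα⟩ : ∃ α : ℝ, ω.arg = 2 * α := ⟨ω.arg / 2, by ring⟩
  have hdir : descentDir ω = I * exp (-α * I) := by rw [descentDir, hα]; push_cast; ring_nf
  rw [hα] at hcosθ hpδ ⊢
  rw [hdir] at hpδ ⊢
  have hpi := Real.pi_gt_three
  have hpi' := Real.pi_lt_d2
  -- `cos 2α > -1/2` keeps `2α` within `[-2π/3, 2π/3]`, hence `cos α ≥ 1/2`
  have hα3 : |α| ≤ π / 3 := by
    have h1 : |2 * α| ≤ π := hα ▸ abs_arg_le_pi ω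
    by_contra! h
    have h2 : Real.cos (2 * α) < -(1 / 2) := by
      rw [← Real.cos_abs, show -(1 / 2 : ℝ) = Real.cos (2 * π / 3) by
        rw [show 2 * π / 3 = π - π / 3 by ring, Real.cos_pi_sub, Real.cos_pi_div_three]]
      refine Real.cos_lt_cos_of_nonneg_of_le_pi (by positivity) h1 ?_
      rw [abs_mul, abs_two]; linarith
    have h3 : Real.exp (-11) ≤ 1 := Real.exp_le_one_iff.2 (by norm_num)
    linarith
  obtain ⟨hα1, hα2⟩ := abs_le.1 hα3
  have hcos : 1 / 2 ≤ Real.cos α := by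
    rw [← Real.cos_abs, ← Real.cos_pi_div_three]
    exact Real.cos_le_cos_of_nonneg_of_le_pi (abs_nonneg _) (by linarith) hα3
  set Y : ℝ := (π - 2 * α) / Real.cos α with hY
  have hYc : Y * Real.cos α = π - 2 * α := div_mul_cancel₀ _ (by linarith)
  have hY11 : Y ≤ 11 := by rw [hY, div_le_iff₀ (by linarith)]; nlinarith
  have hY1 : 1 ≤ Y := by
    rw [hY, le_div_iff₀ (by linarith)]; linarith [Real.cos_le_one α]
  have hmono := antitoneOn_re_phase_ray hα3
  have hpray : ∀ y ∈ Set.Icc δ Y,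
      (exp ((2 * α : ℝ) * I) * phase (I * exp (-α * I) * y)).re ≤ -c := fun y hy =>
    (hmono ⟨hδ.le, by linarith⟩ ⟨hδ.le.trans hy.1, hy.2⟩ hy.1).trans hpδ
  have hr0 : 0 ≤ ‖ω‖ := by linarith
  have hnd : ‖I * exp (-α * I)‖ = 1 := hdir ▸ norm_descentDir ω
  -- along the ray
  have hray : ‖P (I * exp (-α * I) * Y) - P (I * exp (-α * I) * δ)‖ ≤
      Real.exp (11 + 61 * lam) * 11 * Real.exp (-(‖ω‖ * c)) := by
    have hd : ∀ y : ℝ, HasDerivAt (fun y : ℝ => P (I * exp (-α * I) * y))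
        (saddleIntegrand lam ω (I * exp (-α * I) * y) * (I * exp (-α * I))) y := fun y =>
      (hP _).comp_real_path (by simpa using (ofRealCLM.hasDerivAt (x := y)).const_mul _)
    refine (norm_image_sub_le_of_norm_deriv_le_segment' (a := δ) (b := Y)
      (C := Real.exp (11 + 61 * lam) * Real.exp (-(‖ω‖ * c)))
      (fun y _ => (hd y).hasDerivWithinAt) (fun y hy => ?_) Y ⟨by linarith, le_rfl⟩).trans ?_
    · rw [norm_mul, hnd, mul_one, ← Real.exp_add]
      refine (norm_saddleIntegrand_le hlam _ _).trans (Real.exp_le_exp.2 ?_)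
      have h1 := hpray y ⟨hy.1, hy.2.le⟩
      rw [hα]
      have h2 : |(I * exp (-α * I) * y).re| ≤ 11 := by
        refine (abs_re_le_norm _).trans ?_
        rw [norm_mul, hnd, one_mul, norm_real, Real.norm_eq_abs, abs_of_nonneg (by linarith [hy.1])]
        linarith [hy.2]
      have h3 : (I * exp (-α * I) * y).re ^ 2 ≤ 121 := by
        rw [← sq_abs]; nlinarith [abs_nonneg (I * exp (-α * I) * y).re]
      nlinarith [mul_le_mul_of_nonneg_left h1 hr0, (abs_le.1 h2).2,
        mul_le_mul_of_nonneg_left h3 hlam.le]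
    · rw [mul_right_comm]
      gcongr
      linarith
  -- along the horizontal line
  -- the ray `s = i e^{-iα} y` meets the line `Im s = π - 2α` at `y = Y`, where `Re s = X`
  set X : ℝ := Y * Real.sin α with hX
  have hcorner : I * exp (-α * I) * Y = X + (π - 2 * α : ℝ) * I := by
    rw [← hYc, hX, exp_mul_I, ← ofReal_neg, ← ofReal_cos, ← ofReal_sin, Real.cos_neg, Real.sin_neg]
    push_cast
    linear_combination (-(Y : ℂ) * Complex.sin α) * I_sq
  have hXabs : |X| ≤ 11 := by
    rw [hX, abs_mul, abs_of_nonneg (by linarith : 0 ≤ Y)]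
    nlinarith [Real.abs_sin_le_one α, abs_nonneg (Real.sin α)]
  obtain ⟨hX1, hX2⟩ := abs_le.1 hXabs
  have hhor : ∀ x : ℝ, X ≤ x →
      (exp ((2 * α : ℝ) * I) * phase (x + (π - 2 * α : ℝ) * I)).re ≤
        -c - (Real.exp x - Real.exp X) / 2 := by
    intro x hx
    have h0 := hpray Y ⟨by linarith, le_rfl⟩
    rw [hcorner, re_phase_horizontal] at h0
    rw [re_phase_horizontal]
    -- the derivative in `x` is `-e^x - cos 2α`, and `-cos 2α ≤ e^{-11} / 2 ≤ e^X / 2`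
    have h2 : Real.exp X * (x - X + 1) ≤ Real.exp x := by
      have := Real.add_one_le_exp (x - X)
      calc _ ≤ Real.exp X * Real.exp (x - X) := by gcongr
        _ = _ := by rw [← Real.exp_add]; congr 1; ring
    have h3 : Real.exp (-11) ≤ Real.exp X := Real.exp_le_exp.2 hX1
    nlinarith [mul_nonneg (sub_nonneg.2 hx) (sub_nonneg.2 h3),
      mul_nonneg (sub_nonneg.2 hx) (by linarith : 0 ≤ Real.cos (2 * α) + Real.exp (-11) / 2)]
  have htail : ‖P (R + (π - 2 * α : ℝ) * I) - P (X + (π - 2 * α : ℝ) * I)‖ ≤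
      Real.exp (C₁ + Real.exp 11 / 2) * Real.exp 11 * Real.exp (-(‖ω‖ * c)) := by
    set K : ℝ := Real.exp (C₁ + Real.exp 11 / 2) * Real.exp (-(‖ω‖ * c)) with hK
    have hd : ∀ x : ℝ, HasDerivAt (fun x : ℝ => P (x + (π - 2 * α : ℝ) * I))
        (saddleIntegrand lam ω (x + (π - 2 * α : ℝ) * I)) x := fun x => by
      have := (hP (x + (π - 2 * α : ℝ) * I)).comp_real_path
        (γ := fun x : ℝ => x + (π - 2 * α : ℝ) * I)
        ((ofRealCLM.hasDerivAt (x := x)).add_const ((π - 2 * α : ℝ) * I))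
      simpa using this
    have hB : ∀ x : ℝ, HasDerivAt (fun x : ℝ => K * (Real.exp 11 - Real.exp (-x)))
        (K * Real.exp (-x)) x := fun x => by
      have := (((hasDerivAt_neg x).exp.const_sub (Real.exp 11)).const_mul K)
      simpa using this
    have := image_norm_le_of_norm_deriv_right_le_deriv_boundary (a := X) (b := R)
      (f := fun x : ℝ => P (x + (π - 2 * α : ℝ) * I) - P (X + (π - 2 * α : ℝ) * I))
      (fun x _ => ((hd x).sub_const _).continuousAt.continuousWithinAt)
      (fun x _ => ((hd x).sub_const _).hasDerivWithinAt)
      (B := fun x : ℝ => K * (Real.exp 11 - Real.exp (-x))) ?_ hB (fun x hx => ?_)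
      (Set.right_mem_Icc.2 (by linarith))
    · refine this.trans ?_
      have h1 := Real.exp_pos (-R)
      have h2 : 0 ≤ K := by positivity
      rw [mul_right_comm _ (Real.exp 11), ← hK]
      exact mul_le_mul_of_nonneg_left (by linarith) h2
    · have : Real.exp (-X) ≤ Real.exp 11 := Real.exp_le_exp.2 (by linarith)
      have : 0 ≤ K := by positivity
      simp only [sub_self, norm_zero]
      exact mul_nonneg this (by linarith)
    · refine (norm_saddleIntegrand_le hlam _ _).trans ?_
      rw [hK, ← Real.exp_add, ← Real.exp_add]
      refine Real.exp_le_exp.2 ?_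
      have h1 := hhor x hx.1
      have h2 := hC₁ x (by linarith [hx.1])
      rw [hα]
      simp only [add_re, ofReal_re, re_ofReal_mul, I_re, mul_zero, add_zero]
      have h3 : Real.exp X ≤ Real.exp 11 := Real.exp_le_exp.2 hX2
      have h4 : Real.exp X ≤ Real.exp x := Real.exp_le_exp.2 hx.1
      nlinarith [mul_le_mul_of_nonneg_left h1 hr0,
        mul_nonneg (sub_nonneg.2 hω) (sub_nonneg.2 h4)]
  rw [← hcorner] at htail
  calc _ = ‖(P (R + (π - 2 * α : ℝ) * I) - P (I * exp (-α * I) * Y)) +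
        (P (I * exp (-α * I) * Y) - P (I * exp (-α * I) * δ))‖ := by rw [sub_add_sub_cancel]
    _ ≤ _ := (norm_add_le _ _).trans (add_le_add htail hray)
    _ = _ := by ring

open scoped ComplexConjugate in
/-- The lower half of the contour, obtained from the upper one by complex conjugation. -/
theorem exists_lower_bound {lam : ℝ} (hlam : 0 < lam) {δ c : ℝ} (hδ : 0 < δ)
    (hδ1 : δ < 1) :
    ∃ C : ℝ, ∀ ω : ℂ, 1 ≤ ‖ω‖ → -(Real.exp (-11) / 2) * ‖ω‖ ≤ ω.re →
      (exp (ω.arg * I) * phase (-(descentDir ω * δ))).re ≤ -c →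
      ∀ P : ℂ → ℂ, (∀ s, HasDerivAt P (saddleIntegrand lam ω s) s) →
      ∀ R : ℝ, 11 ≤ R →
        ‖P (R + (-π - ω.arg : ℝ) * I) - P (-(descentDir ω * δ))‖ ≤
          C * Real.exp (-(‖ω‖ * c)) := by
  obtain ⟨C, hC⟩ := exists_upper_bound hlam hδ hδ1
  refine ⟨C, fun ω hω hre hp P hP R hR => ?_⟩
  have harg : ω.arg ≠ π := by
    intro h
    have h1 := cos_arg_of_le hω hre
    have h2 : Real.exp (-11) ≤ 1 := Real.exp_le_one_iff.2 (by norm_num)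
    rw [h, Real.cos_pi] at h1
    linarith
  have hca : (conj ω).arg = -ω.arg := by rw [arg_conj, if_neg harg]
  have hdir : descentDir (conj ω) * δ = conj (-(descentDir ω * δ)) := by
    simp only [descentDir, hca, map_neg, map_mul, conj_I, ← exp_conj, conj_ofReal]
    push_cast
    ring_nf
  have hphase : ∀ s, phase (conj s) = conj (phase s) := fun s => by
    simp [phase, exp_conj]
  have hG : ∀ s, saddleIntegrand lam (conj ω) s = conj (saddleIntegrand lam ω (conj s)) := by
    intro s
    simp only [saddleIntegrand, ← exp_conj, map_add, map_mul, map_div₀, map_pow, conj_conj,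
      conj_ofReal, ← hphase, map_ofNat]
  have hexp : exp ((conj ω).arg * I) = conj (exp (ω.arg * I)) := by
    rw [← exp_conj, hca]; simp
  have := hC (conj ω) (by rwa [norm_conj]) (by rwa [norm_conj, conj_re])
    (by rw [hdir, hphase, hexp, ← map_mul, conj_re]; exact hp)
    (conj ∘ P ∘ conj) (fun s => by
      have := (hP (conj s)).conj_conj
      rw [conj_conj] at this
      rw [hG]; exact this) R hR
  rw [hdir, norm_conj] at this
  simp only [Function.comp_apply, conj_conj, ← map_sub, norm_conj] at this
  convert this using 4
  rw [hca]
  simp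
  ring

/-! ### The coordinate in which the phase is quadratic -/

/-- The local coordinate at the saddle point, `s(z) = log (1 - ℓ(z))`, written without the
logarithm; it makes the phase equal to `z² / 2`. -/
noncomputable def saddleCoord (z : ℂ) : ℂ := -ell z - z ^ 2 / 2

theorem eventually_exp_saddleCoord : ∀ᶠ z in 𝓝 (0 : ℂ), exp (saddleCoord z) = 1 - ell z := by
  filter_upwards [isEllGerm_ell.2.2.2] with z hz
  have h1 : exp (saddleCoord z) * exp (ell z - 1) = (1 - ell z) * exp (ell z - 1) := by
    rw [← Complex.exp_add, sub_mul, one_mul, saddleCoord,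
      show -ell z - z ^ 2 / 2 + (ell z - 1) = -1 - z ^ 2 / 2 by ring]
    linear_combination hz
  exact mul_right_cancel₀ (exp_ne_zero _) h1

/-- The change of variables `s = s(z)` turns the integrand into `-e^{ωz²/2} V(z)`. -/
theorem eventually_saddleIntegrand_saddleCoord (lam : ℝ) : ∀ᶠ z in 𝓝 (0 : ℂ),
    HasDerivAt saddleCoord (-deriv ell z - z) z ∧ ∀ ω : ℂ,
      saddleIntegrand lam ω (saddleCoord z) * (-deriv ell z - z) =
        -(exp (ω * z ^ 2 / 2) * V lam z) := by
  filter_upwards [eventually_exp_saddleCoord.eventually_nhds,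
    isEllGerm_ell.1.eventually_analyticAt] with z hz hzA
  have hl := hzA.differentiableAt.hasDerivAt
  have hs : HasDerivAt saddleCoord (-deriv ell z - z) z := by
    refine (hl.neg.sub ((hasDerivAt_pow 2 z).div_const 2)).congr_deriv ?_
    simp
  refine ⟨hs, fun ω => ?_⟩
  have h1 : exp (saddleCoord z) * (-deriv ell z - z) = -deriv ell z :=
    (hs.cexp.congr_of_eventuallyEq (EventuallyEq.symm hz)).unique (hl.const_sub 1)
  have h2 : phase (saddleCoord z) = z ^ 2 / 2 := by
    rw [phase, hz.self_of_nhds, saddleCoord]; ring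
  have h3 : saddleIntegrand lam ω (saddleCoord z) = exp (ω * z ^ 2 / 2) * exp (saddleCoord z) *
      exp (lam / 2 * (ell z ^ 2 + z ^ 2 * ell z + z ^ 4 / 4)) := by
    rw [saddleIntegrand, h2, ← Complex.exp_add, ← Complex.exp_add]
    congr 1
    simp only [saddleCoord]
    ring
  rw [h3, V]
  linear_combination (exp (ω * z ^ 2 / 2) *
    exp (lam / 2 * (ell z ^ 2 + z ^ 2 * ell z + z ^ 4 / 4))) * h1

theorem analyticAt_V (lam : ℝ) : AnalyticAt ℂ (V lam) 0 := by
  have h := isEllGerm_ell.1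
  have h2 := h.deriv
  unfold V
  fun_prop

theorem saddleCoord_add_isBigO :
    (fun z => saddleCoord z + z) =O[𝓝 0] fun z => ‖z‖ ^ 2 := by
  have h := (isEllGerm_ell.1.hasFPowerSeriesAt).isBigO_sub_partialSum_pow 2
  have e : ∀ y : ℂ, (FormalMultilinearSeries.ofScalars ℂ
      (fun n => iteratedDeriv n ell 0 / (n)!)).partialSum 2 y = y := by
    intro y
    simp [FormalMultilinearSeries.partialSum, Finset.sum_range_succ, isEllGerm_ell.2.1,
      isEllGerm_ell.2.2.1, iteratedDeriv_one]
  simp only [e, zero_add] at h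
  have h2 : (fun z : ℂ => z ^ 2 / 2) =O[𝓝 0] fun z => ‖z‖ ^ 2 := by
    refine Asymptotics.IsBigO.of_bound 1 (Eventually.of_forall fun z => ?_)
    simp
  refine (h.neg_left.sub h2).congr_left fun z => ?_
  simp only [saddleCoord]; ring

theorem V_sub_taylor_isBigO (lam : ℝ) (n : ℕ) :
    (fun z => V lam z - ∑ k ∈ Finset.range n, Vcoeff lam k * z ^ k) =O[𝓝 0] fun z => ‖z‖ ^ n := by
  have h := (analyticAt_V lam).hasFPowerSeriesAt.isBigO_sub_partialSum_pow n
  simpa [FormalMultilinearSeries.partialSum, Vcoeff, mul_comm] using h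

/-- Near the points `±i e^{-iθ/2} δ` of the ray of steepest descent the rotated phase is at most
`-δ²/4`. -/
theorem re_phase_le {C δ : ℝ} (hC : 0 ≤ C) (hδ : 0 < δ) (hδC : δ * (6 * C + 32) ≤ 1) {u z w : ℂ}
    (hu : ‖u‖ = 1) (hz : ‖z‖ = δ) (huz : u * z ^ 2 = -(δ : ℂ) ^ 2) (hw : ‖w - z‖ ≤ C * δ ^ 2) :
    (u * phase w).re ≤ -(δ ^ 2 / 4) := by
  have hCδ : C * δ ^ 2 ≤ δ := by nlinarith [mul_nonneg hC hδ.le]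
  have hδ1 : δ ≤ 1 / 32 := by nlinarith [mul_nonneg hC hδ.le]
  have hwn : ‖w‖ ≤ 2 * δ := by
    calc ‖w‖ = ‖w - z + z‖ := by rw [sub_add_cancel]
      _ ≤ _ := norm_add_le _ _
      _ ≤ _ := by linarith
  have h1 : ‖phase w - w ^ 2 / 2‖ ≤ ‖w‖ ^ 3 := by
    have := exp_bound (x := w) (by linarith) (n := 3) (by norm_num)
    simp only [Finset.sum_range_succ, Finset.range_zero, Finset.sum_empty] at this
    norm_num [Nat.factorial] at this
    calc _ = ‖exp w - (1 + w + w ^ 2 / 2)‖ := by rw [phase]; congr 1; ring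
      _ ≤ _ := this.trans (by nlinarith [pow_nonneg (norm_nonneg w) 3])
  have h2 : ‖w ^ 2 - z ^ 2‖ ≤ C * δ ^ 2 * (3 * δ) := by
    rw [show w ^ 2 - z ^ 2 = (w - z) * (w + z) by ring, norm_mul]
    gcongr
    exact (norm_add_le _ _).trans (by linarith)
  have h3 : u * phase w = ((-(δ ^ 2 / 2) : ℝ) : ℂ) + u * ((phase w - w ^ 2 / 2) +
      (w ^ 2 - z ^ 2) / 2) := by
    push_cast
    linear_combination huz / 2
  have h4 : ‖u * ((phase w - w ^ 2 / 2) + (w ^ 2 - z ^ 2) / 2)‖ ≤ δ ^ 2 / 4 := by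
    rw [norm_mul, hu, one_mul]
    refine (norm_add_le _ _).trans ?_
    rw [norm_div, norm_ofNat]
    have h5 : ‖w‖ ^ 3 ≤ (2 * δ) ^ 3 := by gcongr
    nlinarith [mul_le_mul_of_nonneg_left hδC (sq_nonneg δ)]
  rw [h3, add_re, ofReal_re]
  linarith [(re_le_norm _).trans h4]

theorem exp_arg_mul_descentDir_sq (ω : ℂ) : exp (ω.arg * I) * descentDir ω ^ 2 = -1 := by
  rw [descentDir, mul_pow, I_sq, ← Complex.exp_nat_mul]
  have : exp (ω.arg * I) * exp ((2 : ℕ) * (-(ω.arg / 2 : ℝ) * I)) = 1 := by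
    rw [← Complex.exp_add, ← exp_zero]; congr 1; push_cast; ring
  linear_combination -this

theorem mul_descentDir_sq (ω : ℂ) : ω * descentDir ω ^ 2 = -‖ω‖ := by
  conv_lhs => rw [← norm_mul_exp_arg_mul_I ω, mul_assoc]
  rw [norm_mul_exp_arg_mul_I, exp_arg_mul_descentDir_sq]; ring

theorem descentDir_mul_sqrt {ω : ℂ} (hω : ω ≠ 0) :
    descentDir ω * √(2 * π / ‖ω‖) = I * √(2 * π) * (1 / ω ^ (1 / 2 : ℂ)) := by
  have hr : 0 < ‖ω‖ := norm_pos_iff.2 hω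
  have h1 : ω ^ (1 / 2 : ℂ) = √‖ω‖ * exp ((ω.arg / 2 : ℝ) * I) := by
    rw [cpow_def_of_ne_zero hω, Complex.log, Real.sqrt_eq_rpow,
      Real.rpow_def_of_pos hr, ofReal_exp, ← Complex.exp_add]
    congr 1; push_cast; ring
  have h2 : (√‖ω‖ : ℂ) ≠ 0 := by exact_mod_cast (Real.sqrt_pos.2 hr).ne'
  rw [h1, Real.sqrt_div (by positivity), ofReal_div, descentDir, neg_mul, Complex.exp_neg]
  have := exp_ne_zero ((ω.arg / 2 : ℝ) * I)
  field_simp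

/-! ### Expansion of the contour integral at the saddle point -/

/-- The asymptotic expansion of the saddle point integral, uniformly in `arg ω`. The integral over
the contour from `∞ - i(π + arg ω)` to `∞ + i(π - arg ω)` appears through the values of an
arbitrary primitive `P` of the integrand. -/
theorem exists_saddle_expansion {lam : ℝ} (hlam : 0 < lam) (N : ℕ) :
    ∃ C : ℝ, ∀ ω : ℂ, 1 ≤ ‖ω‖ → -(Real.exp (-11) / 2) * ‖ω‖ ≤ ω.re →
      ∀ P : ℂ → ℂ, (∀ s, HasDerivAt P (saddleIntegrand lam ω s) s) →
      ∀ R : ℝ, 11 ≤ R →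
        ‖P (R + (π - ω.arg : ℝ) * I) - P (R + (-π - ω.arg : ℝ) * I) -
            I * √(2 * π) * (1 / ω ^ (1 / 2 : ℂ)) * ∑ n ∈ Finset.range (N + 1),
              ((2 * n)! : ℂ) * Vcoeff lam (2 * n) / (2 ^ n * (n ! : ℂ)) * (-1 / ω) ^ n‖ ≤
          C / (‖ω‖ ^ (N + 1) * √‖ω‖) := by
  obtain ⟨C₁, hC₁, hs⟩ := (saddleCoord_add_isBigO).exists_nonneg
  obtain ⟨M, hM, hV⟩ := (V_sub_taylor_isBigO lam (2 * N + 2)).exists_nonneg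
  obtain ⟨δ₀, hδ₀, hloc⟩ := Metric.eventually_nhds_iff_ball.1
    ((eventually_saddleIntegrand_saddleCoord lam).and
      (hs.bound.and (hV.bound.and (analyticAt_V lam).eventually_analyticAt)))
  obtain ⟨δ, hδ, hδδ₀, hδC⟩ : ∃ δ : ℝ, 0 < δ ∧ δ < δ₀ ∧ δ * (6 * C₁ + 32) ≤ 1 := by
    refine ⟨min (δ₀ / 2) (1 / (6 * C₁ + 32)), by positivity,
      (min_le_left _ _).trans_lt (by linarith), ?_⟩
    calc _ ≤ 1 / (6 * C₁ + 32) * (6 * C₁ + 32) := by gcongr; exact min_le_right _ _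
      _ = 1 := by field_simp
  have hδ1 : δ ≤ 1 / 32 := by nlinarith [mul_nonneg hC₁ hδ.le]
  have hball : ∀ z ∈ Metric.closedBall (0 : ℂ) δ, z ∈ Metric.ball (0 : ℂ) δ₀ := fun z hz =>
    Metric.closedBall_subset_ball hδδ₀ hz
  obtain ⟨C₂, hC₂⟩ := exists_laplace_bound (f := V lam) (a := Vcoeff lam) (M := M) hδ N
    (fun z hz => (hloc z (hball z hz)).2.2.2.continuousAt.continuousWithinAt)
    (fun z hz => by
      have := (hloc z (hball z hz)).2.2.1
      rwa [norm_pow, norm_norm] at this)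
  obtain ⟨C₃, hC₃⟩ := exists_upper_bound (c := δ ^ 2 / 4) hlam hδ (by linarith)
  obtain ⟨C₄, hC₄⟩ := exists_lower_bound (c := δ ^ 2 / 4) hlam hδ (by linarith)
  obtain ⟨C₅, hC₅, hexp⟩ := exists_exp_neg_mul_le (c := δ ^ 2 / 4) (by positivity) N
  set C₆ : ℝ := Real.exp (2 + 2 * lam) with hC₆
  refine ⟨(|C₃| + C₆ + C₆ + |C₄|) * C₅ + C₂, fun ω hω hre P hP R hR => ?_⟩
  have hω0 : ω ≠ 0 := by rintro rfl; norm_num at hω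
  have hr0 : 0 < ‖ω‖ := by linarith
  set d := descentDir ω with hd
  have hdn : ‖d‖ = 1 := norm_descentDir ω
  have hu : ‖exp (ω.arg * I)‖ = 1 := norm_exp_ofReal_mul_I _
  have hudd : exp (ω.arg * I) * d ^ 2 = -1 := exp_arg_mul_descentDir_sq ω
  have hnp : ‖d * δ‖ = δ := by rw [norm_mul, hdn, one_mul, norm_real, Real.norm_eq_abs, abs_of_pos hδ]
  -- near both ends of the central arc the integrand is exponentially small
  have hphase : ∀ z, ‖z‖ = δ → exp (ω.arg * I) * z ^ 2 = -(δ : ℂ) ^ 2 → ∀ w,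
      ‖w - z‖ ≤ C₁ * δ ^ 2 → (exp (ω.arg * I) * phase w).re ≤ -(δ ^ 2 / 4) := fun z hz hz2 w hw =>
    re_phase_le hC₁ hδ hδC hu hz hz2 hw
  have hcd : ∀ z, ‖z‖ = δ → ‖saddleCoord (-z) - z‖ ≤ C₁ * δ ^ 2 := fun z hz => by
    have := (hloc (-z) (hball _ (by simp [hz]))).2.1
    rwa [norm_pow, norm_norm, norm_neg, hz, ← sub_eq_add_neg] at this
  have hjoin : ∀ z, ‖z‖ = δ → exp (ω.arg * I) * z ^ 2 = -(δ : ℂ) ^ 2 →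
      ‖P (saddleCoord (-z)) - P z‖ ≤ C₆ * Real.exp (-(‖ω‖ * (δ ^ 2 / 4))) := by
    intro z hz hz2
    have hCδ : C₁ * δ ^ 2 ≤ 1 := by nlinarith [mul_nonneg hC₁ hδ.le]
    refine (Convex.norm_image_sub_le_of_norm_hasDerivWithin_le
      (C := C₆ * Real.exp (-(‖ω‖ * (δ ^ 2 / 4))))
      (fun w _ => (hP w).hasDerivWithinAt) (fun w hw => ?_)
      (convex_closedBall z (C₁ * δ ^ 2)) (Metric.mem_closedBall_self (by positivity))
      (y := saddleCoord (-z)) (by simpa [dist_eq_norm] using hcd z hz)).trans ?_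
    · rw [mem_closedBall_iff_norm] at hw
      refine (norm_saddleIntegrand_le hlam ω w).trans ?_
      rw [hC₆, ← Real.exp_add]
      refine Real.exp_le_exp.2 ?_
      have h1 := hphase z hz hz2 w hw
      have h2 : ‖w‖ ≤ 2 := by
        calc ‖w‖ = ‖w - z + z‖ := by rw [sub_add_cancel]
          _ ≤ _ := norm_add_le _ _
          _ ≤ _ := by linarith
      have h3 : |w.re| ≤ 2 := (abs_re_le_norm w).trans h2
      have h4 : w.re ^ 2 ≤ 4 := by rw [← sq_abs]; nlinarith [abs_nonneg w.re]
      nlinarith [mul_le_mul_of_nonneg_left h1 hr0.le, (abs_le.1 h3).2,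
        mul_le_mul_of_nonneg_left h4 hlam.le]
    · exact mul_le_of_le_one_right (by positivity) ((hcd z hz).trans hCδ)
  have hz2 : exp (ω.arg * I) * (d * δ) ^ 2 = -(δ : ℂ) ^ 2 := by
    linear_combination (δ : ℂ) ^ 2 * hudd
  have hz2' : exp (ω.arg * I) * (-(d * δ)) ^ 2 = -(δ : ℂ) ^ 2 := by
    linear_combination (δ : ℂ) ^ 2 * hudd
  have b1 := hC₃ ω hω hre (hphase _ hnp hz2 _ (by rw [sub_self, norm_zero]; positivity)) P hP R hR
  have b2 := hjoin _ hnp hz2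
  have b3 := hjoin (-(d * δ)) (by rw [norm_neg, hnp]) hz2'
  have b4 := hC₄ ω hω hre
    (hphase _ (by rw [norm_neg, hnp]) hz2' _ (by rw [sub_self, norm_zero]; positivity)) P hP R hR
  -- the central arc, parametrised by `z = -dη`
  have hcen : P (saddleCoord (-(d * δ))) - P (saddleCoord (d * δ)) =
      d * ∫ y in (-δ)..δ, (Real.exp (-(‖ω‖ * y ^ 2 / 2)) : ℂ) * V lam (-d * y) := by
    have hmem : ∀ y ∈ Set.uIcc (-δ) δ, -d * (y : ℂ) ∈ Metric.closedBall (0 : ℂ) δ := by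
      intro y hy
      rw [Set.uIcc_of_le (by linarith)] at hy
      simpa [hdn] using abs_le.2 ⟨hy.1, hy.2⟩
    have hder : ∀ y ∈ Set.uIcc (-δ) δ, HasDerivAt (fun y : ℝ => P (saddleCoord (-d * y)))
        (d * ((Real.exp (-(‖ω‖ * y ^ 2 / 2)) : ℂ) * V lam (-d * y))) y := by
      intro y hy
      obtain ⟨h1, h2⟩ := (hloc _ (hball _ (hmem y hy))).1
      have h3 : HasDerivAt (fun y : ℝ => -d * (y : ℂ)) (-d) y := by
        simpa using (ofRealCLM.hasDerivAt (x := y)).const_mul (-d)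
      have h4 := HasDerivAt.comp_real_path (γ := fun y : ℝ => -d * (y : ℂ)) h1 h3
      refine ((hP _).comp_real_path h4).congr_deriv ?_
      rw [← mul_assoc, h2 ω, ofReal_exp]
      have : ω * (-d * y) ^ 2 / 2 = ((-(‖ω‖ * y ^ 2 / 2) : ℝ) : ℂ) := by
        push_cast
        linear_combination (y : ℂ) ^ 2 / 2 * mul_descentDir_sq ω
      rw [this]; ring
    rw [← intervalIntegral.integral_const_mul, intervalIntegral.integral_eq_sub_of_hasDerivAt hder]
    · simp
    · refine ContinuousOn.intervalIntegrable ?_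
      have hV : ContinuousOn (fun y : ℝ => V lam (-d * y)) (Set.uIcc (-δ) δ) := fun y hy =>
        ContinuousAt.continuousWithinAt <| ContinuousAt.comp (f := fun y : ℝ => -d * (y : ℂ))
          (hloc _ (hball _ (hmem y hy))).2.2.2.continuousAt (by fun_prop)
      exact continuousOn_const.mul (ContinuousOn.mul (by fun_prop) hV)
  have b5 := hC₂ ‖ω‖ hω (-d) (by rw [norm_neg, hdn])
  have hpow : (-d) ^ 2 / (‖ω‖ : ℂ) = -1 / ω := by
    have : (‖ω‖ : ℂ) ≠ 0 := by exact_mod_cast hr0.ne'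
    rw [div_eq_div_iff this hω0]
    linear_combination mul_descentDir_sq ω
  rw [hpow] at b5
  set S := ∑ n ∈ Finset.range (N + 1),
    ((2 * n)! : ℂ) * Vcoeff lam (2 * n) / (2 ^ n * (n ! : ℂ)) * (-1 / ω) ^ n with hS
  set J := ∫ y in (-δ)..δ, (Real.exp (-(‖ω‖ * y ^ 2 / 2)) : ℂ) * V lam (-d * y) with hJ
  rw [neg_neg] at b3
  have hE := hexp ‖ω‖ hω
  set E := Real.exp (-(‖ω‖ * (δ ^ 2 / 4))) with hEdef
  have hE0 : 0 < E := Real.exp_pos _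
  have e : P (R + (π - ω.arg : ℝ) * I) - P (R + (-π - ω.arg : ℝ) * I) -
      I * √(2 * π) * (1 / ω ^ (1 / 2 : ℂ)) * S =
      (P (R + (π - ω.arg : ℝ) * I) - P (d * δ)) - (P (saddleCoord (-(d * δ))) - P (d * δ)) +
        (P (saddleCoord (d * δ)) - P (-(d * δ))) - (P (R + (-π - ω.arg : ℝ) * I) - P (-(d * δ))) +
        d * (J - √(2 * π / ‖ω‖) * S) := by
    linear_combination hcen + S * descentDir_mul_sqrt hω0
  have b6 : ‖d * (J - √(2 * π / ‖ω‖) * S)‖ ≤ C₂ / (‖ω‖ ^ (N + 1) * √‖ω‖) := by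
    rw [norm_mul, hdn, one_mul]; exact b5
  rw [e]
  calc _ ≤ C₃ * E + C₆ * E + C₆ * E + C₄ * E + C₂ / (‖ω‖ ^ (N + 1) * √‖ω‖) :=
        norm_add_le_of_le (norm_sub_le_of_le (norm_add_le_of_le (norm_sub_le_of_le b1 b2) b3) b4) b6
    _ ≤ (|C₃| + C₆ + C₆ + |C₄|) * E + C₂ / (‖ω‖ ^ (N + 1) * √‖ω‖) := by
        nlinarith [le_abs_self C₃, le_abs_self C₄]
    _ ≤ (|C₃| + C₆ + C₆ + |C₄|) * (C₅ / (‖ω‖ ^ (N + 1) * √‖ω‖)) +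
        C₂ / (‖ω‖ ^ (N + 1) * √‖ω‖) := by gcongr
    _ = _ := by ring

/-! ### The Hankel contour integral -/

/-- With `τ = log t`, the Hankel integral of a function with the primitive `Q` is the limit of the
increments of `Q` between the ends of the two horizontal lines `Im τ = ±π`. -/
theorem tendsto_hankelIntegral {Φ : LogSurface → ℂ} {F Q : ℂ → ℂ} (hΦ : ∀ τ, Φ (.ofLog τ) = F τ)
    (hF : Continuous F) (hQ : ∀ τ, HasDerivAt Q (F τ) τ)
    (hup : IntegrableOn (fun σ : ℝ => F (σ + π * I)) (Set.Ioi 0))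
    (hlow : IntegrableOn (fun σ : ℝ => F (σ - π * I)) (Set.Ioi 0)) :
    Tendsto (fun R : ℝ => Q (R + π * I) - Q (R - π * I)) atTop (𝓝 (hankelIntegral Φ)) := by
  simp only [hankelIntegral, hΦ]
  have hhor : ∀ (b : ℂ) (R : ℝ), ∫ σ in (0 : ℝ)..R, F (σ + b) = Q (R + b) - Q b := by
    intro b R
    have hd : ∀ σ : ℝ, HasDerivAt (fun σ : ℝ => Q (σ + b)) (F (σ + b)) σ := fun σ => by
      simpa using HasDerivAt.comp_real_path (γ := fun σ : ℝ => (σ : ℂ) + b) (hQ (σ + b))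
        ((ofRealCLM.hasDerivAt (x := σ)).add_const b)
    rw [intervalIntegral.integral_eq_sub_of_hasDerivAt (fun σ _ => hd σ)
      (Continuous.intervalIntegrable (by fun_prop) _ _)]
    simp
  have hver : I * (∫ θ in (-π)..π, F (θ * I)) = Q (π * I) - Q (-(π * I)) := by
    have hd : ∀ θ : ℝ, HasDerivAt (fun θ : ℝ => Q (θ * I)) (I * F (θ * I)) θ := fun θ => by
      simpa [mul_comm] using HasDerivAt.comp_real_path (γ := fun θ : ℝ => (θ : ℂ) * I) (hQ (θ * I))
        ((ofRealCLM.hasDerivAt (x := θ)).mul_const I)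
    rw [← intervalIntegral.integral_const_mul,
      intervalIntegral.integral_eq_sub_of_hasDerivAt (fun θ _ => hd θ)
      (Continuous.intervalIntegrable (by fun_prop) _ _)]
    simp
  have t1 := intervalIntegral_tendsto_integral_Ioi 0 hup tendsto_id
  have t2 := intervalIntegral_tendsto_integral_Ioi 0 hlow tendsto_id
  simp only [id_eq, sub_eq_add_neg, hhor] at t1 t2 ⊢
  rw [hver]
  refine ((t2.neg.add_const _).add t1).congr fun R => ?_
  ring

theorem integrableOn_exp_exp_add_sq {lam : ℝ} (hlam : 0 < lam) (A : ℂ) {b : ℝ}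
    (hb : exp (b * I) = -1) :
    IntegrableOn (fun σ : ℝ => exp (exp (σ + b * I) + lam / 2 * (σ + b * I - A) ^ 2))
      (Set.Ioi 0) := by
  obtain ⟨C, hC⟩ := exists_horizontal_majorant (lam := 2 * lam) (by positivity)
  have hK := (integrableOn_exp_neg_Ioi 0).const_mul (Real.exp (C + lam * A.re ^ 2))
  refine hK.mono' (Continuous.aestronglyMeasurable (by fun_prop))
    ((ae_restrict_iff' measurableSet_Ioi).2 (Eventually.of_forall fun σ hσ => ?_))
  have hσ0 : 0 < σ := hσ
  rw [norm_exp, ← Real.exp_add, Complex.exp_add, hb]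
  refine Real.exp_le_exp.2 ?_
  have h1 : (exp (σ : ℂ) * -1).re = -Real.exp σ := by simp [exp_ofReal_re]
  have h2 : ((lam : ℂ) / 2 * (σ + b * I - A) ^ 2).re =
      lam / 2 * ((σ - A.re) ^ 2 - (b - A.im) ^ 2) := by
    rw [← ofReal_ofNat, ← ofReal_div, re_ofReal_mul, sq, mul_re]
    simp only [sub_re, add_re, ofReal_re, re_ofReal_mul, I_re, sub_im, add_im, ofReal_im,
      im_ofReal_mul, I_im]
    ring
  rw [add_re, h1, h2]
  have := hC σ (by linarith)
  nlinarith [Real.exp_pos σ, mul_nonneg hlam.le (sq_nonneg (b - A.im)),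
    mul_nonneg hlam.le (sq_nonneg (σ + A.re))]

/-- The integrand of `h` in the coordinate centred at the saddle point `Log ω`, where
`ω + lam Log ω = lam A + 1`. -/
theorem exp_saddle_shift {lam : ℝ} (hlam : lam ≠ 0) {ω A : ℂ} (hω : ω ≠ 0)
    (hsaddle : ω + lam * Complex.log ω = lam * A + 1) (s : ℂ) :
    exp (exp (s + Complex.log ω) + lam / 2 * (s + Complex.log ω - A) ^ 2) =
      exp ((1 - ω) ^ 2 / (2 * lam) + ω) * saddleIntegrand lam ω s := by
  have hl : (lam : ℂ) ≠ 0 := by exact_mod_cast hlam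
  have h1 : Complex.log ω - A = (1 - ω) / lam := by
    rw [eq_div_iff hl]; linear_combination hsaddle
  rw [saddleIntegrand, ← Complex.exp_add, Complex.exp_add s, Complex.exp_log hω, add_sub_assoc, h1,
    phase]
  congr 1
  field_simp
  ring

/-- The asymptotic expansion of the Hankel integral of `h` in terms of its saddle point. -/
theorem exists_hankel_expansion {lam : ℝ} (hlam : 0 < lam) (N : ℕ) :
    ∃ C : ℝ, ∀ ω A : ℂ, 1 ≤ ‖ω‖ → -(Real.exp (-11) / 2) * ‖ω‖ ≤ ω.re →
      ω + lam * Complex.log ω = lam * A + 1 → ∀ Φ : LogSurface → ℂ,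
      (∀ τ, Φ (.ofLog τ) = exp (exp τ + lam / 2 * (τ - A) ^ 2)) →
        ‖hankelIntegral Φ / exp ((1 - ω) ^ 2 / (2 * lam) + ω) -
            I * √(2 * π) * (1 / ω ^ (1 / 2 : ℂ)) * ∑ n ∈ Finset.range (N + 1),
              ((2 * n)! : ℂ) * Vcoeff lam (2 * n) / (2 ^ n * (n ! : ℂ)) * (-1 / ω) ^ n‖ ≤
          C / (‖ω‖ ^ (N + 1) * √‖ω‖) := by
  obtain ⟨C, hC⟩ := exists_saddle_expansion hlam N
  refine ⟨C, fun ω A hω hre hsaddle Φ hΦ => ?_⟩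
  have hω0 : ω ≠ 0 := by rintro rfl; norm_num at hω
  set K := exp ((1 - ω) ^ 2 / (2 * lam) + ω) with hK
  have hK0 : K ≠ 0 := exp_ne_zero _
  have hdiff : Differentiable ℂ (saddleIntegrand lam ω) := by
    unfold saddleIntegrand phase; fun_prop
  obtain ⟨P, hP⟩ := hdiff.isExactOn_univ
  simp only [Set.mem_univ, true_implies] at hP
  have hQ : ∀ τ, HasDerivAt (fun τ => K * P (τ - Complex.log ω))
      (exp (exp τ + lam / 2 * (τ - A) ^ 2)) τ := by
    intro τ
    have h := exp_saddle_shift hlam.ne' hω0 hsaddle (τ - Complex.log ω)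
    rw [sub_add_cancel] at h
    rw [h]
    exact ((hP _).comp_sub_const τ _).const_mul K
  have hm : exp (((-π : ℝ) : ℂ) * I) = -1 := by
    rw [ofReal_neg, neg_mul, Complex.exp_neg, exp_pi_mul_I]; norm_num
  have hlow := integrableOn_exp_exp_add_sq hlam A hm
  simp only [ofReal_neg, neg_mul, ← sub_eq_add_neg] at hlow
  have ht := tendsto_hankelIntegral hΦ (by fun_prop) hQ
    (integrableOn_exp_exp_add_sq hlam A exp_pi_mul_I) hlow
  have ht2 := ((ht.div_const K).sub_const (I * √(2 * π) * (1 / ω ^ (1 / 2 : ℂ)) *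
    ∑ n ∈ Finset.range (N + 1),
      ((2 * n)! : ℂ) * Vcoeff lam (2 * n) / (2 ^ n * (n ! : ℂ)) * (-1 / ω) ^ n)).norm
  refine le_of_tendsto ht2 ?_
  filter_upwards [eventually_ge_atTop (11 + Real.log ‖ω‖)] with R hR
  have e1 : (R : ℂ) + π * I - Complex.log ω =
      (R - Real.log ‖ω‖ : ℝ) + (π - ω.arg : ℝ) * I := by
    rw [Complex.log]; push_cast; ring
  have e2 : (R : ℂ) - π * I - Complex.log ω =
      (R - Real.log ‖ω‖ : ℝ) + (-π - ω.arg : ℝ) * I := by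
    rw [Complex.log]; push_cast; ring
  have := hC ω hω hre P hP (R - Real.log ‖ω‖) (by linarith)
  rwa [← mul_sub, mul_div_cancel_left₀ _ hK0, e1, e2]

/-! ### The saddle point for large `|x|` -/

/-- Solutions of `w + Log w = Z` are large and nearly contained in the right half-plane when
`Re Z` is large, whatever `Im Z` is. -/
theorem eventually_lambert_bounds {κ : ℝ} (hκ : 0 < κ) (B : ℝ) :
    ∀ᶠ M : ℝ in atTop, ∀ w : ℂ, w ≠ 0 → (w + Complex.log w).re = M →
      B ≤ ‖w‖ ∧ -κ * ‖w‖ ≤ w.re := by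
  obtain ⟨r₁, hr₁⟩ := eventually_atTop.1 (Real.isLittleO_log_id_atTop.bound hκ)
  filter_upwards [eventually_ge_atTop 0, eventually_ge_atTop (2 * B),
    eventually_ge_atTop (2 * r₁)] with M hM0 hMB hMr w hw hwM
  rw [add_re, log_re] at hwM
  have hpos := norm_pos_iff.2 hw
  have h1 := Real.log_le_sub_one_of_pos hpos
  have h2 := re_le_norm w
  have h3 := hr₁ ‖w‖ (by linarith)
  rw [Real.norm_eq_abs, Real.norm_eq_abs, id, abs_of_pos hpos] at h3
  exact ⟨by linarith, by linarith [le_abs_self (Real.log ‖w‖)]⟩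

theorem LogSurface.log_ofPos (c : ℝ) (hc : 0 < c) :
    (LogSurface.ofPos c hc).log = (Real.log c : ℂ) := by
  simp [LogSurface.log, LogSurface.ofPos]

/-- The saddle point equation satisfied by `ω̃`, and its location for large `|x|`. -/
theorem eventually_omegaTilde {q : ℝ} (hq0 : 0 < q) (hq1 : q < 1) {κ : ℝ} (hκ : 0 < κ) :
    ∀ᶠ x in LogSurface.atInfinity, 1 ≤ ‖omegaTilde q hq0 hq1 x‖ ∧
      -κ * ‖omegaTilde q hq0 hq1 x‖ ≤ (omegaTilde q hq0 hq1 x).re ∧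
      omegaTilde q hq0 hq1 x + (-1 / Real.log q : ℝ) * Complex.log (omegaTilde q hq0 hq1 x) =
        (-1 / Real.log q : ℝ) * (x.log - Real.log q / 2) + 1 := by
  set lam := -1 / Real.log q with hlamdef
  have hlam : 0 < lam := neg_one_div_log_pos hq0 hq1
  have hL : Real.log q ≠ 0 := (Real.log_neg hq0 hq1).ne
  have hz : ∀ x : LogSurface, (LogSurface.ofPos (q ^ (-(3 / 2) : ℝ)) (Real.rpow_pos_of_pos hq0 _) * x /
      LogSurface.ofPos lam hlam).log = x.log - ((3 / 2 * Real.log q + Real.log lam : ℝ) : ℂ) := by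
    intro x
    rw [LogSurface.log_div, LogSurface.log_mul, LogSurface.log_ofPos, LogSurface.log_ofPos,
      Real.log_rpow hq0]
    push_cast; ring
  have ht : Tendsto (fun x : LogSurface =>
      (x.log - ((3 / 2 * Real.log q + Real.log lam : ℝ) : ℂ)).re) LogSurface.atInfinity atTop := by
    have h1 : Tendsto (fun x : LogSurface => Real.log x.modulus) LogSurface.atInfinity atTop :=
      Real.tendsto_log_atTop.comp tendsto_comap
    refine (tendsto_atTop_add_const_right _ (-(3 / 2 * Real.log q + Real.log lam)) h1).congr
      fun x => ?_
    rw [sub_re, ofReal_re]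
    simp [LogSurface.log, sub_eq_add_neg]
  filter_upwards [ht.eventually (eventually_lambert_bounds hκ (1 / lam)),
    ht.eventually_gt_atTop (-1)] with x hx hx1
  have hspec := lambertW_spec (z := LogSurface.ofPos (q ^ (-(3 / 2) : ℝ))
    (Real.rpow_pos_of_pos hq0 _) * x / LogSurface.ofPos lam hlam) (Or.inl (by rw [hz]; exact hx1))
  have hom : omegaTilde q hq0 hq1 x = lam * lambertW (LogSurface.ofPos (q ^ (-(3 / 2) : ℝ))
    (Real.rpow_pos_of_pos hq0 _) * x / LogSurface.ofPos lam hlam) := rfl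
  rw [hz] at hspec
  generalize lambertW _ = W at hspec hom
  have hW0 := slitPlane_ne_zero hspec.1
  obtain ⟨h1, h2⟩ := hx W hW0 (by rw [hspec.2])
  have hn : ‖(lam : ℂ) * W‖ = lam * ‖W‖ := by
    rw [norm_mul, norm_real, Real.norm_eq_abs, abs_of_pos hlam]
  rw [hom]
  refine ⟨?_, ?_, ?_⟩
  · rw [hn]; rwa [div_le_iff₀' hlam] at h1
  · rw [hn, re_ofReal_mul]; nlinarith [mul_le_mul_of_nonneg_left h2 hlam.le]
  · rw [log_ofReal_mul hlam hW0]
    have hl : (lam : ℂ) * Real.log q = -1 := by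
      rw [← ofReal_mul, hlamdef, div_mul_cancel₀ _ hL]; simp
    have h3 := hspec.2
    push_cast at h3
    linear_combination (lam : ℂ) * h3 - hl

theorem hSol_integrand {q : ℝ} (hq0 : 0 < q) (x : LogSurface) (τ : ℂ) :
    exp ((LogSurface.ofLog τ).toComplex - 1 / (2 * (Real.log q : ℂ)) *
        (LogSurface.ofPos (Real.sqrt q) (Real.sqrt_pos.2 hq0) * LogSurface.ofLog τ / x).log ^ 2) =
      exp (exp τ + (-1 / Real.log q : ℝ) / 2 * (τ - (x.log - Real.log q / 2)) ^ 2) := by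
  rw [← LogSurface.exp_log, LogSurface.log_div, LogSurface.log_mul, LogSurface.log_ofPos,
    LogSurface.log_ofLog, Real.log_sqrt hq0.le]
  congr 1
  push_cast
  rw [← div_div, neg_div, neg_div]
  ring

/-- The constants of the saddle point method combine to the prefactor of the expansion. -/
theorem hSol_prefactor {q : ℝ} (hq0 : 0 < q) (hq1 : q < 1) (ω : ℂ) :
    (Real.sqrt (kappa q) : ℂ) / (2 * π * I) * (I * √(2 * π)) *
        exp ((1 - ω) ^ 2 / (2 * (-1 / Real.log q : ℝ)) + ω) =
      1 / (Real.sqrt (q * Real.log q⁻¹) : ℂ) *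
        exp (-((Real.log q : ℂ) / 2) * ω ^ 2 + (1 + (Real.log q : ℂ)) * ω) := by
  have hneg := Real.log_neg hq0 hq1
  have hL : (Real.log q : ℂ) ≠ 0 := by exact_mod_cast hneg.ne
  have e1 : (1 - ω) ^ 2 / (2 * ((-1 / Real.log q : ℝ) : ℂ)) + ω = ((-(Real.log q / 2) : ℝ) : ℂ) +
      (-((Real.log q : ℂ) / 2) * ω ^ 2 + (1 + (Real.log q : ℂ)) * ω) := by
    push_cast
    field_simp
    ring
  have e2 : Real.exp (-(Real.log q / 2)) = 1 / √q := by
    rw [Real.exp_neg, Real.exp_half, Real.exp_log hq0, one_div]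
  have e3 : √(kappa q) * √(2 * π) = 2 * π / √(Real.log q⁻¹) := by
    have h1 : kappa q = 2 * π / Real.log q⁻¹ := by
      rw [kappa, Real.log_inv, neg_div, div_neg]
    have hpi := Real.pi_pos
    rw [h1, Real.sqrt_div (by positivity), div_mul_eq_mul_div, Real.mul_self_sqrt (by positivity)]
  have e3' : (√(kappa q) : ℂ) * √(2 * π) = 2 * π / √(Real.log q⁻¹) := by exact_mod_cast e3
  have hpi : (π : ℂ) ≠ 0 := by exact_mod_cast Real.pi_ne_zero
  rw [e1, Complex.exp_add, ← ofReal_exp, e2, Real.sqrt_mul hq0.le, ← mul_assoc]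
  congr 1
  have e4 : (√(kappa q) : ℂ) / (2 * π * I) * (I * √(2 * π)) =
      (√(kappa q) : ℂ) * √(2 * π) / (2 * π) := by
    have := I_ne_zero
    field_simp
  rw [e4, e3']
  push_cast
  rw [div_right_comm, div_self (by simp [hpi]), div_mul_div_comm, one_mul, mul_comm]

theorem Vcoeff_zero (lam : ℝ) : Vcoeff lam 0 = 1 := by
  simp [Vcoeff, V, isEllGerm_ell.2.1, isEllGerm_ell.2.2.1]

end Pantograph

theorem theorem7p3 (q : ℝ) (hq0 : 0 < q) (hq1 : q < 1) (N : ℕ) (hN : 1 ≤ N) :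
    ∃ ε : LogSurface → ℂ,
      ε =O[LogSurface.atInfinity] (fun x => 1 / omegaTilde q hq0 hq1 x ^ (N + 1)) ∧
      ∀ᶠ x in LogSurface.atInfinity,
        hSol q hq0 x =
          1 / (Real.sqrt (q * Real.log q⁻¹) : ℂ) *
            exp (-((Real.log q : ℂ) / 2) * omegaTilde q hq0 hq1 x ^ 2 +
              (1 + (Real.log q : ℂ)) * omegaTilde q hq0 hq1 x) *
            (1 / omegaTilde q hq0 hq1 x ^ (1 / 2 : ℂ)) *
            (1 + ∑ n ∈ Finset.Icc 1 N,
                ((2 * n)! : ℂ) * Vcoeff (-1 / Real.log q) (2 * n) / (2 ^ n * (n ! : ℂ)) *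
                  (-1 / omegaTilde q hq0 hq1 x) ^ n
              + ε x) := by
  obtain ⟨C, hC⟩ := exists_hankel_expansion (neg_one_div_log_pos hq0 hq1) N
  set D : ℂ → ℂ := fun ω => 1 / (Real.sqrt (q * Real.log q⁻¹) : ℂ) *
    exp (-((Real.log q : ℂ) / 2) * ω ^ 2 + (1 + (Real.log q : ℂ)) * ω) *
    (1 / ω ^ (1 / 2 : ℂ)) with hD
  set S : ℂ → ℂ := fun ω => 1 + ∑ n ∈ Finset.Icc 1 N,
    ((2 * n)! : ℂ) * Vcoeff (-1 / Real.log q) (2 * n) / (2 ^ n * (n ! : ℂ)) * (-1 / ω) ^ n with hS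
  have hSr : ∀ ω, ∑ n ∈ Finset.range (N + 1), ((2 * n)! : ℂ) * Vcoeff (-1 / Real.log q) (2 * n) /
      (2 ^ n * (n ! : ℂ)) * (-1 / ω) ^ n = S ω := by
    intro ω
    rw [Finset.range_eq_Ico, Finset.sum_eq_sum_Ico_succ_bot (Nat.succ_pos N)]
    have : Finset.Ico (0 + 1) (N + 1) = Finset.Icc 1 N := by ext; simp
    rw [this]
    simp [hS, Vcoeff_zero]
  have hsq : 0 < √(q * Real.log q⁻¹) :=
    Real.sqrt_pos.2 (mul_pos hq0 (Real.log_pos ((one_lt_inv₀ hq0).2 hq1)))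
  have hD0 : ∀ ω, ω ≠ 0 → D ω ≠ 0 := by
    intro ω hω
    have h1 : (√(q * Real.log q⁻¹) : ℂ) ≠ 0 := by exact_mod_cast hsq.ne'
    have h2 : ω ^ (1 / 2 : ℂ) ≠ 0 := by simp [cpow_eq_zero_iff, hω]
    simp only [hD]
    exact mul_ne_zero (mul_ne_zero (one_div_ne_zero h1) (exp_ne_zero _)) (one_div_ne_zero h2)
  have hev := eventually_omegaTilde hq0 hq1 (κ := Real.exp (-11) / 2) (by positivity)
  refine ⟨fun x => hSol q hq0 x / D (omegaTilde q hq0 hq1 x) - S (omegaTilde q hq0 hq1 x), ?_, ?_⟩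
  · refine Asymptotics.IsBigO.of_bound (C / √(2 * π)) ?_
    filter_upwards [hev] with x hx
    generalize omegaTilde q hq0 hq1 x = ω at hx ⊢
    obtain ⟨h1, h2, h3⟩ := hx
    have hω0 : ω ≠ 0 := by rintro rfl; norm_num at h1
    have hr : 0 < ‖ω‖ := by linarith
    have hmain := hC ω _ h1 h2 h3 (fun t => exp (t.toComplex - 1 / (2 * (Real.log q : ℂ)) *
      (LogSurface.ofPos (Real.sqrt q) (Real.sqrt_pos.2 hq0) * t / x).log ^ 2))
      (hSol_integrand hq0 x)
    rw [hSr] at hmain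
    set J := hankelIntegral _ with hJ
    set K := exp ((1 - ω) ^ 2 / (2 * ((-1 / Real.log q : ℝ) : ℂ)) + ω) with hK
    have hK0 : K ≠ 0 := exp_ne_zero _
    set b : ℂ := I * √(2 * π) * (1 / ω ^ (1 / 2 : ℂ)) with hb
    have hbn : ‖b‖ = √(2 * π) / √‖ω‖ := by
      rw [hb, ← descentDir_mul_sqrt hω0, norm_mul, norm_descentDir, one_mul, norm_real,
        Real.norm_of_nonneg (Real.sqrt_nonneg _), Real.sqrt_div (by positivity)]
    have hb0 : b ≠ 0 := by
      rw [← norm_pos_iff, hbn]; positivity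
    have hDb : D ω = (Real.sqrt (kappa q) : ℂ) / (2 * π * I) * b * K := by
      simp only [hD]
      rw [← hSol_prefactor hq0 hq1 ω]
      ring
    have hκ0 : (Real.sqrt (kappa q) : ℂ) / (2 * π * I) ≠ 0 := by
      intro h
      exact hD0 ω hω0 (by rw [hDb, h]; ring)
    have hquot : hSol q hq0 x / D ω - S ω = (J / K - b * S ω) / b := by
      rw [hDb, hSol, ← hJ]
      generalize (Real.sqrt (kappa q) : ℂ) / (2 * π * I) = c at hκ0 ⊢
      field_simp
    rw [hquot, norm_div, hbn, norm_div, norm_one, norm_pow]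
    calc _ ≤ C / (‖ω‖ ^ (N + 1) * √‖ω‖) / (√(2 * π) / √‖ω‖) := by gcongr
      _ = _ := by field_simp
  · filter_upwards [hev] with x hx
    have hω0 : omegaTilde q hq0 hq1 x ≠ 0 := by
      intro h; rw [h] at hx; norm_num at hx
    change hSol q hq0 x = D (omegaTilde q hq0 hq1 x) * (S (omegaTilde q hq0 hq1 x) + _)
    rw [add_sub_cancel, mul_div_cancel₀ _ (hD0 _ hω0)]
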